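/- Let $K\subseteq\mathbb{R}^n$ be nonempty, closed and convex (possibly unbounded), with Euclidean diameter $d=\sup_{\theta,\theta'\in K}\|\theta-\theta'\|\in[0,\infty]$, and let $\sigma>0$. For $\mu\in K$ observe $Y=\mu+\xi$ with $\xi\sim N(0,\sigma^2\mathbb{I}_n)$, let $\hat\mu=\hat\mu(Y)=\operatorname{argmin}_{\nu\in K}\|Y-\nu\|^2$ be the least squares estimator, and let $$\varepsilon_K(\sigma)=\Big(\sup_{\mu\in K}\mathbb{E}\|\hat\mu-\mu\|^2\Big)^{1/2}.$$ For $\mu\in K$ and $\varepsilon\ge 0$ let $B(\mu,\varepsilon)$ be the closed Euclidean ball and $w_\mu(\varepsilon)=\mathbb{E}\sup_{t\in B(\mu,\varepsilon)\cap K}\langle x,t\rangle$, $x\sim N(0,\mathbb{I}_n)$, the local Gaussian width. For $c>1$ and $\tau>0$ put $$\overline\varepsilon(\tau)=\sup\Big\{\varepsilon\ge 0:\ \sup_{\mu\in K}\Big[w_\mu(\varepsilon)-\inf_{\nu\in B(\mu,\varepsilon)\cap K}w_\nu(\varepsilon/c)\Big]\ge\Big(4+\frac4c\Big)\frac{\varepsilon^2}{2\tau}\Big\},$$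 and set $\sigma'=4c\sigma/(c-1)$. Then the following hold. (i) For every $c>1$ there is a constant $L>0$ depending only on $c$ such that, for all $n$, $K$ and $\sigma$ as above, if $\overline\varepsilon(\sigma)\ge L\sigma$ then $$\overline\varepsilon(\sigma)/c\ \le\ \varepsilon_K(\sigma)\ \le\ \overline\varepsilon(\sigma').$$ (ii) For every $A>0$ there are constants $a,b>0$ depending only on $A$ such that, for all $c>1$ and all $n$, $K$ and $\sigma$ as above, if $\overline\varepsilon(\sigma')\le A\sigma$ then $$a\min(\sigma,d)\ \le\ \varepsilon_K(\sigma)\ \le\ b\min(\sigma,d).$$ -/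

import Mathlib

open MeasureTheory ProbabilityTheory Metric
open scoped ENNReal RealInnerProductSpace

noncomputable section

/-- The Gaussian width `w(T) = 𝔼 sup_{t ∈ T} ⟨x, t⟩` with `x ∼ N(0, I_n)`. -/
def gaussianWidth {n : ℕ} (T : Set (EuclideanSpace ℝ (Fin n))) : ℝ :=
  ∫ x, (⨆ t : T, ⟪x, (t : EuclideanSpace ℝ (Fin n))⟫)
    ∂(stdGaussian (EuclideanSpace ℝ (Fin n)))

/-- The local Gaussian width `w_μ(ε) = w(B(μ, ε) ∩ K)`, where `B(μ, ε)` is the closed ball. -/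
def localWidth {n : ℕ} (K : Set (EuclideanSpace ℝ (Fin n)))
    (μ : EuclideanSpace ℝ (Fin n)) (ε : ℝ) : ℝ :=
  gaussianWidth (closedBall μ ε ∩ K)

/-- `p` is a least squares estimate for the observation `y` under the constraint `K`:
it minimizes `ν ↦ ‖y - ν‖ ^ 2` over `K`. -/
def IsLeastSquares {n : ℕ} (K : Set (EuclideanSpace ℝ (Fin n)))
    (y p : EuclideanSpace ℝ (Fin n)) : Prop :=
  p ∈ K ∧ ∀ ν ∈ K, ‖y - p‖ ^ 2 ≤ ‖y - ν‖ ^ 2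

/-- The least squares estimator `y ↦ argmin_{ν ∈ K} ‖y - ν‖ ^ 2`. For `K` nonempty, closed and
convex the minimizer exists and is unique, see `isLeastSquares_iff`. -/
def lse {n : ℕ} (K : Set (EuclideanSpace ℝ (Fin n)))
    (y : EuclideanSpace ℝ (Fin n)) : EuclideanSpace ℝ (Fin n) :=
  Classical.epsilon (IsLeastSquares K y)

theorem isLeastSquares_lse {n : ℕ} {K : Set (EuclideanSpace ℝ (Fin n))}
    (hne : K.Nonempty) (hcl : IsClosed K) (y : EuclideanSpace ℝ (Fin n)) :
    IsLeastSquares K y (lse K y) := by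
  apply Classical.epsilon_spec (p := IsLeastSquares K y)
  obtain ⟨p, hp, h⟩ := hcl.exists_infDist_eq_dist hne y
  refine ⟨p, hp, fun ν hν => ?_⟩
  have h1 : dist y p ≤ dist y ν := h ▸ infDist_le_dist_of_mem hν
  rw [dist_eq_norm, dist_eq_norm] at h1
  gcongr

theorem isLeastSquares_iff {n : ℕ} {K : Set (EuclideanSpace ℝ (Fin n))}
    (hne : K.Nonempty) (hcl : IsClosed K) (hco : Convex ℝ K)
    (y p : EuclideanSpace ℝ (Fin n)) :
    IsLeastSquares K y p ↔ p = lse K y := by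
  have hq := isLeastSquares_lse hne hcl y
  refine ⟨fun hp => ?_, fun h => h ▸ hq⟩
  set q := lse K y
  have hm : (1 / 2 : ℝ) • p + (1 / 2 : ℝ) • q ∈ K :=
    hco hp.1 hq.1 (by norm_num) (by norm_num) (by norm_num)
  have h1 := hp.2 _ hq.1
  have h2 := hp.2 _ hm
  have h3 := parallelogram_law_with_norm ℝ (y - p) (y - q)
  have e1 : y - p + (y - q) = (2 : ℝ) • (y - ((1 / 2 : ℝ) • p + (1 / 2 : ℝ) • q)) := by
    module
  have e2 : y - p - (y - q) = q - p := by abel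
  have h4 := hq.2 _ hm
  rw [e1, e2, norm_smul, Real.norm_ofNat] at h3
  have h5 : ‖q - p‖ = 0 := by nlinarith [norm_nonneg (q - p)]
  exact (sub_eq_zero.mp (norm_eq_zero.mp h5)).symm

/-- The risk `𝔼 ‖μ̂ - μ‖ ^ 2` of the least squares estimator `μ̂ = μ̂(Y)` for
`Y = μ + σ ξ` with `ξ ∼ N(0, I_n)`, i.e. with noise `N(0, σ ^ 2 I_n)`. -/
def lseRisk {n : ℕ} (K : Set (EuclideanSpace ℝ (Fin n))) (σ : ℝ)
    (μ : EuclideanSpace ℝ (Fin n)) : ℝ :=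
  ∫ ξ, ‖lse K (μ + σ • ξ) - μ‖ ^ 2 ∂(stdGaussian (EuclideanSpace ℝ (Fin n)))

/-- The worst case rate `ε_K(σ) = (sup_{μ ∈ K} 𝔼 ‖μ̂ - μ‖ ^ 2) ^ (1 / 2)`. -/
def worstCaseRate {n : ℕ} (K : Set (EuclideanSpace ℝ (Fin n))) (σ : ℝ) : ℝ :=
  √(⨆ μ : K, lseRisk K σ μ)

/-- The supremum `ε̄(σ)` of the `ε ≥ 0` with
`sup_{μ ∈ K} [w_μ(ε) - inf_{ν ∈ B(μ, ε) ∩ K} w_ν(ε / c)] ≥ (4 + 4 / c) ε ^ 2 / (2 σ)`. -/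
def widthRate {n : ℕ} (K : Set (EuclideanSpace ℝ (Fin n))) (c σ : ℝ) : ℝ :=
  sSup {ε : ℝ | 0 ≤ ε ∧
    (⨆ μ : K, (localWidth K μ ε
      - ⨅ ν : (closedBall (μ : EuclideanSpace ℝ (Fin n)) ε ∩ K :
          Set (EuclideanSpace ℝ (Fin n))), localWidth K ν (ε / c)))
      ≥ (4 + 4 / c) * (ε ^ 2 / (2 * σ))}

/-- `σ ∧ d`, where `d ∈ [0, ∞]` is the diameter of `K`; it equals `σ` when `K` is unbounded. -/
def minNoiseDiam {n : ℕ} (K : Set (EuclideanSpace ℝ (Fin n))) (σ : ℝ) : ℝ :=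
  (min (ENNReal.ofReal σ) (ediam K)).toReal

end

/-! ### Gaussian moments, and rotation invariance of a pair of independent Gaussians. -/

section GaussianMoments

variable {n : ℕ}

/-! Fix `μ` and let `g(ε)` be the supremum of `⟪ξ, t - μ⟫` over `t ∈ B(μ, ε) ∩ K`. It is concave in
`ε` with mean `w_μ(ε)`, and the error `r = ‖μ̂ - μ‖` is a supergradient of `σ g` at `r`
(`localSup_le_lseError_tangent`). So `σ` times the slope of `g` over `[s, u]` is at least `r` if `u
< r` and at most `r` if `r < s`. As `g(ε)` is `ε`-Lipschitz in `ξ`, a dimension-free Poincaré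
inequality bounds its variance by a multiple of `ε ^ 2` (`integral_widthDeviation_sq_le`). The
slopes of `w_μ` thus locate `r` up to an error of order `σ u / (u - s)`.

Lower bound in (i): an admissible `ε` gives a base point `ν` where the width grows strongly between
`ε / c` and `2 * ε`, so `r` rarely falls below `ε / c`. To lose no constant, the rare shortfalls are
paid for by a likely excess (`sq_le_lseRisk`). Upper bound in (i): were `R = ε_K(σ)` larger than
`ε̄(σ')`, small slopes below `R` would give `R ^ 2 ≤ q R ^ 2 + M σ ^ 2` with `q < 1`, impossible
when `R` is a large multiple of `σ` (`worstCaseRate_le_widthRate`).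

In (ii), the upper bound uses small slopes at a radius of order `σ`, together with `μ̂, μ ∈ K`. The
lower bound is a two-point argument valid for every `K` (`mul_gaussianTailOne_le_lseRisk_add`). -/

lemma integrable_norm_sq_stdGaussian :
    Integrable (fun x : EuclideanSpace ℝ (Fin n) => ‖x‖ ^ 2)
      (stdGaussian (EuclideanSpace ℝ (Fin n))) := by
  have := (IsGaussian.memLp_two_id (μ := stdGaussian (EuclideanSpace ℝ (Fin n)))).norm
  simpa using this.integrable_sq

lemma integrable_of_quadratic_growth {f : EuclideanSpace ℝ (Fin n) → ℝ} (hf : Continuous f)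
    (a b : ℝ) (h : ∀ x, |f x| ≤ a + b * ‖x‖ ^ 2) :
    Integrable f (stdGaussian (EuclideanSpace ℝ (Fin n))) := by
  refine Integrable.mono' (g := fun x => a + b * ‖x‖ ^ 2) ?_ hf.aestronglyMeasurable
    (Filter.Eventually.of_forall h)
  exact (integrable_const a).add (integrable_norm_sq_stdGaussian.const_mul b)

lemma integrable_prod_of_quadratic_growth
    {f : EuclideanSpace ℝ (Fin n) × EuclideanSpace ℝ (Fin n) → ℝ} (hf : Continuous f)
    (a b : ℝ) (h : ∀ z, |f z| ≤ a + b * (‖z.1‖ ^ 2 + ‖z.2‖ ^ 2)) :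
    Integrable f ((stdGaussian (EuclideanSpace ℝ (Fin n))).prod
      (stdGaussian (EuclideanSpace ℝ (Fin n)))) := by
  refine Integrable.mono' (g := fun z => a + b * (‖z.1‖ ^ 2 + ‖z.2‖ ^ 2)) ?_
    hf.aestronglyMeasurable (Filter.Eventually.of_forall h)
  exact (integrable_const a).add (((integrable_norm_sq_stdGaussian.comp_fst _).add
    (integrable_norm_sq_stdGaussian.comp_snd _)).const_mul b)

lemma integral_inner_stdGaussian (a : EuclideanSpace ℝ (Fin n)) :
    ∫ x, ⟪x, a⟫ ∂(stdGaussian (EuclideanSpace ℝ (Fin n))) = 0 := by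
  have := integral_strongDual_stdGaussian (innerSL ℝ a)
  simpa [real_inner_comm] using this

lemma integral_inner_sq_stdGaussian (a : EuclideanSpace ℝ (Fin n)) :
    ∫ x, ⟪a, x⟫ ^ 2 ∂(stdGaussian (EuclideanSpace ℝ (Fin n))) = ‖a‖ ^ 2 := by
  have h := variance_dual_stdGaussian (innerSL ℝ a)
  rw [variance_eq_integral (by fun_prop), integral_strongDual_stdGaussian] at h
  simpa using h

lemma integral_norm_sq_stdGaussian :
    ∫ x, ‖x‖ ^ 2 ∂(stdGaussian (EuclideanSpace ℝ (Fin n))) = n := by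
  have h : ∀ x : EuclideanSpace ℝ (Fin n),
      ‖x‖ ^ 2 = ∑ i, ⟪EuclideanSpace.basisFun (Fin n) ℝ i, x⟫ ^ 2 := fun x =>
    ((EuclideanSpace.basisFun (Fin n) ℝ).sum_sq_inner_right x).symm
  simp_rw [h]
  rw [integral_finsetSum]
  · simp_rw [integral_inner_sq_stdGaussian]
    simp
  · intro i _
    refine integrable_of_quadratic_growth (by fun_prop) 0 1 fun x => ?_
    rw [abs_of_nonneg (sq_nonneg _), zero_add, one_mul, sq_le_sq, abs_norm]
    simpa using abs_real_inner_le_norm (EuclideanSpace.basisFun (Fin n) ℝ i) x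

lemma measurePreserving_rotation_stdGaussian (θ : ℝ) :
    MeasurePreserving (ContinuousLinearMap.rotation θ :
        EuclideanSpace ℝ (Fin n) × EuclideanSpace ℝ (Fin n) →L[ℝ] _)
      ((stdGaussian (EuclideanSpace ℝ (Fin n))).prod (stdGaussian (EuclideanSpace ℝ (Fin n))))
      ((stdGaussian (EuclideanSpace ℝ (Fin n))).prod (stdGaussian (EuclideanSpace ℝ (Fin n)))) :=
  ⟨by fun_prop, IsGaussian.map_rotation_eq_self (by simp) θ⟩

end GaussianMoments

/-! ### A dimension-free Poincaré inequality by discrete rotations. -/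

section Poincare

variable {n : ℕ}

/-- The increment of a convex function with gradient `t` along a rotation by the angle `h` is
at most this quantity, evaluated at the end point. -/
noncomputable def rotationIncrement (t : EuclideanSpace ℝ (Fin n) → EuclideanSpace ℝ (Fin n))
    (h : ℝ) (z : EuclideanSpace ℝ (Fin n) × EuclideanSpace ℝ (Fin n)) : ℝ :=
  (1 - Real.cos h) * ⟪t z.1, z.1⟫ + Real.sin h * ⟪t z.1, z.2⟫

variable {t : EuclideanSpace ℝ (Fin n) → EuclideanSpace ℝ (Fin n)} {ε : ℝ}

lemma continuous_rotationIncrement (ht : Continuous t) (h : ℝ) :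
    Continuous (rotationIncrement t h) := by
  unfold rotationIncrement
  fun_prop

lemma inner_sq_le_of_norm_le {a b : EuclideanSpace ℝ (Fin n)} (ha : ‖a‖ ≤ ε) :
    ⟪a, b⟫ ^ 2 ≤ ε ^ 2 * ‖b‖ ^ 2 := by
  rw [← mul_pow, sq_le_sq]
  have hε : 0 ≤ ε := (norm_nonneg a).trans ha
  rw [abs_of_nonneg (mul_nonneg hε (norm_nonneg b))]
  exact (abs_real_inner_le_norm a b).trans (by gcongr)

lemma rotationIncrement_sq_le (hb : ∀ x, ‖t x‖ ≤ ε) (h : ℝ)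
    (z : EuclideanSpace ℝ (Fin n) × EuclideanSpace ℝ (Fin n)) :
    rotationIncrement t h z ^ 2 ≤
      2 * (1 - Real.cos h) ^ 2 * (ε ^ 2 * ‖z.1‖ ^ 2)
        + 2 * Real.sin h ^ 2 * ⟪t z.1, z.2⟫ ^ 2 := by
  have h1 := inner_sq_le_of_norm_le (b := z.1) (hb z.1)
  have h2 := mul_le_mul_of_nonneg_left h1 (sq_nonneg (1 - Real.cos h))
  unfold rotationIncrement
  nlinarith [sq_nonneg ((1 - Real.cos h) * ⟪t z.1, z.1⟫ - Real.sin h * ⟪t z.1, z.2⟫)]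

lemma integrable_inner_sq_prod (ht : Continuous t) (hb : ∀ x, ‖t x‖ ≤ ε) :
    Integrable (fun z : EuclideanSpace ℝ (Fin n) × EuclideanSpace ℝ (Fin n) => ⟪t z.1, z.2⟫ ^ 2)
      ((stdGaussian (EuclideanSpace ℝ (Fin n))).prod
        (stdGaussian (EuclideanSpace ℝ (Fin n)))) := by
  refine integrable_prod_of_quadratic_growth (by fun_prop) 0 (ε ^ 2) fun z => ?_
  rw [abs_of_nonneg (sq_nonneg _)]
  have := inner_sq_le_of_norm_le (b := z.2) (hb z.1)
  nlinarith [mul_nonneg (sq_nonneg ε) (sq_nonneg ‖z.1‖)]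

lemma integrable_rotationIncrement_sq (ht : Continuous t) (hb : ∀ x, ‖t x‖ ≤ ε) (h : ℝ) :
    Integrable (fun z => rotationIncrement t h z ^ 2)
      ((stdGaussian (EuclideanSpace ℝ (Fin n))).prod
        (stdGaussian (EuclideanSpace ℝ (Fin n)))) := by
  refine Integrable.mono' (((((integrable_norm_sq_stdGaussian.comp_fst _).const_mul
    (ε ^ 2)).const_mul (2 * (1 - Real.cos h) ^ 2))).add
    ((integrable_inner_sq_prod ht hb).const_mul (2 * Real.sin h ^ 2)))
    ((continuous_rotationIncrement ht h).pow 2).aestronglyMeasurable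
    (Filter.Eventually.of_forall fun z => ?_)
  rw [Real.norm_of_nonneg (sq_nonneg _)]
  exact rotationIncrement_sq_le hb h z

/-- Given `z.1`, the variable `⟪t z.1, z.2⟫` has second moment `‖t z.1‖ ^ 2`, free of `n`. The
dimension enters only with the factor `(1 - cos h) ^ 2`, of order `h ^ 4`. -/
lemma integral_rotationIncrement_sq_le (ht : Continuous t) (hb : ∀ x, ‖t x‖ ≤ ε) (h : ℝ) :
    ∫ z, rotationIncrement t h z ^ 2 ∂((stdGaussian (EuclideanSpace ℝ (Fin n))).prod
        (stdGaussian (EuclideanSpace ℝ (Fin n)))) ≤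
      2 * (1 - Real.cos h) ^ 2 * (ε ^ 2 * n) + 2 * Real.sin h ^ 2 * ε ^ 2 := by
  set γ := stdGaussian (EuclideanSpace ℝ (Fin n))
  have hi1 : Integrable (fun z : EuclideanSpace ℝ (Fin n) × EuclideanSpace ℝ (Fin n) =>
      2 * (1 - Real.cos h) ^ 2 * (ε ^ 2 * ‖z.1‖ ^ 2)) (γ.prod γ) :=
    ((integrable_norm_sq_stdGaussian.comp_fst _).const_mul _).const_mul _
  have hi2 : Integrable (fun z : EuclideanSpace ℝ (Fin n) × EuclideanSpace ℝ (Fin n) =>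
      2 * Real.sin h ^ 2 * ⟪t z.1, z.2⟫ ^ 2) (γ.prod γ) :=
    (integrable_inner_sq_prod ht hb).const_mul _
  refine (integral_mono (integrable_rotationIncrement_sq ht hb h) (hi1.add hi2)
    (rotationIncrement_sq_le hb h)).trans ?_
  simp only [Pi.add_apply]
  rw [integral_add hi1 hi2]
  simp only [integral_const_mul]
  rw [integral_fun_fst (f := fun x : EuclideanSpace ℝ (Fin n) => ‖x‖ ^ 2),
    integral_prod _ (integrable_inner_sq_prod ht hb)]
  simp_rw [γ, integral_inner_sq_stdGaussian, integral_norm_sq_stdGaussian]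
  simp only [probReal_univ, one_smul]
  gcongr
  have hle : ∫ x, ‖t x‖ ^ 2 ∂γ ≤ ∫ _, ε ^ 2 ∂γ := by
    refine integral_mono_of_nonneg (Filter.Eventually.of_forall fun x => sq_nonneg _)
      (integrable_const _) (Filter.Eventually.of_forall fun x => ?_)
    have := hb x
    dsimp only
    gcongr
  simpa using hle

/-- Telescope along the quarter turn from `z.1` to `z.2`. Using the subgradient at the end of each
step makes every term the same function of a rotated pair, hence equidistributed. -/
lemma sub_le_sum_rotationIncrement {f : EuclideanSpace ℝ (Fin n) → ℝ}
    (hf : ∀ x y, f x - f y ≤ ⟪t x, x - y⟫) {N : ℕ} {h : ℝ} (hN : N * h = Real.pi / 2)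
    (z : EuclideanSpace ℝ (Fin n) × EuclideanSpace ℝ (Fin n)) :
    f z.2 - f z.1 ≤ ∑ k ∈ Finset.range N,
      rotationIncrement t h (ContinuousLinearMap.rotation ((k + 1 : ℕ) * h) z) := by
  have key : ∀ k : ℕ, f (ContinuousLinearMap.rotation ((k + 1 : ℕ) * h) z).1
      - f (ContinuousLinearMap.rotation ((k : ℕ) * h) z).1 ≤
      rotationIncrement t h (ContinuousLinearMap.rotation ((k + 1 : ℕ) * h) z) := by
    intro k
    refine (hf _ _).trans_eq ?_
    have e : (k : ℝ) * h = (k + 1 : ℕ) * h - h := by push_cast; ring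
    have e2 : (ContinuousLinearMap.rotation ((k + 1 : ℕ) * h) z).1
        - (ContinuousLinearMap.rotation ((k : ℕ) * h) z).1 =
        (1 - Real.cos h) • (ContinuousLinearMap.rotation ((k + 1 : ℕ) * h) z).1
          + Real.sin h • (ContinuousLinearMap.rotation ((k + 1 : ℕ) * h) z).2 := by
      rw [e]
      simp only [ContinuousLinearMap.rotation_apply, Real.cos_sub, Real.sin_sub]
      module
    rw [e2, inner_add_right, real_inner_smul_right, real_inner_smul_right, rotationIncrement]
  have := Finset.sum_le_sum (s := Finset.range N) fun k _ => key k
  rw [Finset.sum_range_sub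
    (fun k : ℕ => f (ContinuousLinearMap.rotation ((k : ℕ) * h) z).1), hN] at this
  simpa [ContinuousLinearMap.rotation_apply] using this

lemma integral_sub_sq_le {f : EuclideanSpace ℝ (Fin n) → ℝ} (ht : Continuous t)
    (hb : ∀ x, ‖t x‖ ≤ ε) (hf : ∀ x y, f x - f y ≤ ⟪t x, x - y⟫) :
    ∫ z, (f z.2 - f z.1) ^ 2 ∂((stdGaussian (EuclideanSpace ℝ (Fin n))).prod
        (stdGaussian (EuclideanSpace ℝ (Fin n)))) ≤ 32 * ε ^ 2 := by
  set γ := stdGaussian (EuclideanSpace ℝ (Fin n))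
  -- With this many steps `n * h ^ 2` stays bounded, which absorbs the dimension.
  obtain ⟨N, hNdef⟩ : ∃ N : ℕ, N = n + 1 := ⟨_, rfl⟩
  have hNpos : (0 : ℝ) < N := by rw [hNdef]; positivity
  obtain ⟨h, hh⟩ : ∃ h : ℝ, h = Real.pi / 2 / N := ⟨_, rfl⟩
  have hN : N * h = Real.pi / 2 := by rw [hh]; field_simp
  have hpos : 0 < h := by rw [hh]; positivity
  set G := rotationIncrement t h
  let R : ℕ → EuclideanSpace ℝ (Fin n) × EuclideanSpace ℝ (Fin n) →L[ℝ]
      EuclideanSpace ℝ (Fin n) × EuclideanSpace ℝ (Fin n) :=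
    fun k => ContinuousLinearMap.rotation ((k + 1 : ℕ) * h)
  have hpres : ∀ k, MeasurePreserving (R k) (γ.prod γ) (γ.prod γ) := fun k =>
    measurePreserving_rotation_stdGaussian _
  have hsm : AEStronglyMeasurable (fun z => G z ^ 2) (γ.prod γ) :=
    ((continuous_rotationIncrement ht h).pow 2).aestronglyMeasurable
  have hint : ∀ k, Integrable (fun z => G (R k z) ^ 2) (γ.prod γ) := fun k =>
    (hpres k).integrable_comp_of_integrable (g := fun z => G z ^ 2)
      (integrable_rotationIncrement_sq ht hb h)
  have hval : ∀ k, ∫ z, G (R k z) ^ 2 ∂(γ.prod γ) = ∫ z, G z ^ 2 ∂(γ.prod γ) := fun k => by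
    have := integral_map (μ := γ.prod γ) (φ := R k) (f := fun z => G z ^ 2)
      (hpres k).measurable.aemeasurable (by rw [(hpres k).map_eq]; exact hsm)
    rw [(hpres k).map_eq] at this
    exact this.symm
  let S : EuclideanSpace ℝ (Fin n) × EuclideanSpace ℝ (Fin n) → ℝ :=
    fun z => ∑ k ∈ Finset.range N, G (R k z) ^ 2
  have hSint : Integrable S (γ.prod γ) := integrable_finsetSum _ fun k _ => hint k
  have hSval : ∫ z, S z ∂(γ.prod γ) = N * ∫ z, G z ^ 2 ∂(γ.prod γ) := by
    simp only [S]
    rw [integral_finsetSum _ fun k _ => hint k]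
    simp [hval]
  have hcs : ∀ z, (∑ k ∈ Finset.range N, G (R k z)) ^ 2 ≤ N * S z := fun z => by
    simpa using sq_sum_le_card_mul_sum_sq (s := Finset.range N) (f := fun k => G (R k z))
  -- Subgradients bound increments only from above; exchanging the two components covers the other
  -- sign.
  have hpt : ∀ z, (f z.2 - f z.1) ^ 2 ≤ N * S z + N * S z.swap := by
    intro z
    have h1 := sub_le_sum_rotationIncrement hf hN z
    have h2 := sub_le_sum_rotationIncrement hf hN z.swap
    simp only [Prod.fst_swap, Prod.snd_swap] at h2
    have c1 := hcs z
    have c2 := hcs z.swap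
    have p1 : 0 ≤ N * S z := (sq_nonneg _).trans c1
    have p2 : 0 ≤ N * S z.swap := (sq_nonneg _).trans c2
    rcases le_total 0 (f z.2 - f z.1) with h0 | h0
    · have := pow_le_pow_left₀ h0 h1 2
      simp only [G, R] at c1
      linarith
    · have := pow_le_pow_left₀ (by linarith) h2 2
      simp only [G, R] at c2
      nlinarith
  have hSw : Integrable (fun z => S z.swap) (γ.prod γ) := hSint.swap
  have hSwval : ∫ z, S z.swap ∂(γ.prod γ) = ∫ z, S z ∂(γ.prod γ) := integral_prod_swap S
  have hbound : ∫ z, (f z.2 - f z.1) ^ 2 ∂(γ.prod γ) ≤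
      2 * N ^ 2 * ∫ z, G z ^ 2 ∂(γ.prod γ) := by
    have := integral_mono_of_nonneg (Filter.Eventually.of_forall fun z => sq_nonneg _)
      ((hSint.const_mul (N : ℝ)).add (hSw.const_mul (N : ℝ)))
      (Filter.Eventually.of_forall hpt)
    refine this.trans_eq ?_
    simp only [Pi.add_apply]
    rw [integral_add (hSint.const_mul _) (hSw.const_mul _), integral_const_mul,
      integral_const_mul, hSwval, hSval]
    ring
  refine hbound.trans ?_
  have hG := integral_rotationIncrement_sq_le (n := n) ht hb h
  have hc0 : 0 ≤ 1 - Real.cos h := by linarith [Real.cos_le_one h]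
  have hc1 : 1 - Real.cos h ≤ h ^ 2 / 2 := by linarith [Real.one_sub_sq_div_two_le_cos (x := h)]
  have hc : (1 - Real.cos h) ^ 2 ≤ (h ^ 2 / 2) ^ 2 := by gcongr
  have hs : Real.sin h ^ 2 ≤ h ^ 2 := by
    rw [sq_le_sq]; exact (Real.abs_sin_le_abs)
  have hNh : N * h ≤ 2 := by rw [hN]; linarith [Real.pi_le_four]
  have hNh2 : (N * h) ^ 2 ≤ 4 := by nlinarith [mul_pos hNpos hpos]
  have hn : (n : ℝ) * h ^ 2 ≤ 4 := by
    have h1 : (n : ℝ) ≤ N ^ 2 := by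
      have : n ≤ N ^ 2 := by rw [hNdef]; nlinarith
      exact_mod_cast this
    nlinarith [sq_nonneg h]
  have hε2 := sq_nonneg ε
  calc 2 * (N : ℝ) ^ 2 * ∫ z, G z ^ 2 ∂(γ.prod γ)
      ≤ 2 * (N : ℝ) ^ 2 * (2 * (h ^ 2 / 2) ^ 2 * (ε ^ 2 * n) + 2 * h ^ 2 * ε ^ 2) := by
        refine mul_le_mul_of_nonneg_left (hG.trans ?_) (by positivity)
        gcongr
    _ = ((N * h) ^ 2 * (n * h ^ 2) + 4 * (N * h) ^ 2) * ε ^ 2 := by ring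
    _ ≤ 32 * ε ^ 2 := by
        have : (N * h) ^ 2 * (n * h ^ 2) ≤ 4 * 4 := by gcongr
        gcongr
        linarith

/-- A dimension-free Poincaré inequality for convex functions with a continuous gradient `t`. -/
theorem integral_sub_integral_sq_le {f : EuclideanSpace ℝ (Fin n) → ℝ} (ht : Continuous t)
    (hb : ∀ x, ‖t x‖ ≤ ε) (hf : ∀ x y, f x - f y ≤ ⟪t x, x - y⟫) (hfc : Continuous f) :
    ∫ x, (f x - ∫ y, f y ∂(stdGaussian (EuclideanSpace ℝ (Fin n)))) ^ 2
      ∂(stdGaussian (EuclideanSpace ℝ (Fin n))) ≤ 16 * ε ^ 2 := by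
  set γ := stdGaussian (EuclideanSpace ℝ (Fin n))
  set m := ∫ y, f y ∂γ
  have hε : 0 ≤ ε := (norm_nonneg _).trans (hb 0)
  have hlip : ∀ x, |f x| ≤ |f 0| + ε * ‖x‖ := by
    intro x
    have h1 := hf x 0
    have h2 := hf 0 x
    have h3 := (real_inner_le_norm (t x) (x - 0)).trans
      (mul_le_mul_of_nonneg_right (hb x) (norm_nonneg _))
    have h4 := (real_inner_le_norm (t 0) (0 - x)).trans
      (mul_le_mul_of_nonneg_right (hb 0) (norm_nonneg _))
    simp only [sub_zero, zero_sub, norm_neg] at h1 h2 h3 h4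
    have h5 : |f x - f 0| ≤ ε * ‖x‖ := abs_sub_le_iff.2 ⟨by linarith, by linarith⟩
    linarith [abs_sub_abs_le_abs_sub (f x) (f 0)]
  have hfi : Integrable f γ := by
    refine integrable_of_quadratic_growth hfc (|f 0| + ε) ε fun x => (hlip x).trans ?_
    nlinarith [sq_nonneg (‖x‖ - 1), norm_nonneg x]
  have hφi : Integrable (fun x => f x - m) γ := hfi.sub (integrable_const m)
  have hφ2 : Integrable (fun x => (f x - m) ^ 2) γ := by
    refine integrable_of_quadratic_growth (by fun_prop) (2 * (|f 0| + |m|) ^ 2) (2 * ε ^ 2)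
      fun x => ?_
    rw [abs_of_nonneg (sq_nonneg _), ← sq_abs]
    have h1 : |f x - m| ≤ (|f 0| + |m|) + ε * ‖x‖ := by linarith [abs_sub (f x) m, hlip x]
    have := pow_le_pow_left₀ (abs_nonneg _) h1 2
    nlinarith [sq_nonneg ((|f 0| + |m|) - ε * ‖x‖)]
  have hφ0 : ∫ x, (f x - m) ∂γ = 0 := by
    rw [integral_sub hfi (integrable_const m)]
    simp [m]
  have hmain := integral_sub_sq_le ht hb hf
  -- The cross term integrates to zero by independence, so `hmain` bounds twice the variance.
  have e : ∀ z : EuclideanSpace ℝ (Fin n) × EuclideanSpace ℝ (Fin n), (f z.2 - f z.1) ^ 2 =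
      ((f z.2 - m) ^ 2 + (f z.1 - m) ^ 2) - 2 * ((f z.1 - m) * (f z.2 - m)) := fun z => by ring
  simp_rw [e] at hmain
  rw [integral_sub (by exact (hφ2.comp_snd _).add (hφ2.comp_fst _))
    ((hφi.mul_prod hφi).const_mul 2), integral_add (hφ2.comp_snd _) (hφ2.comp_fst _),
    integral_const_mul, integral_prod_mul (fun x => f x - m) (fun x => f x - m),
    integral_fun_fst (f := fun x => (f x - m) ^ 2),
    integral_fun_snd (f := fun x => (f x - m) ^ 2), hφ0] at hmain
  simp only [probReal_univ, one_smul] at hmain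
  linarith

end Poincare

/-! ### Least squares as metric projection onto a convex set. -/

section LeastSquares

variable {n : ℕ} {K : Set (EuclideanSpace ℝ (Fin n))}

lemma lse_mem (hne : K.Nonempty) (hcl : IsClosed K) (y : EuclideanSpace ℝ (Fin n)) :
    lse K y ∈ K :=
  (isLeastSquares_lse hne hcl y).1

lemma inner_sub_lse_le_zero (hne : K.Nonempty) (hcl : IsClosed K) (hco : Convex ℝ K)
    (y : EuclideanSpace ℝ (Fin n)) {t : EuclideanSpace ℝ (Fin n)} (ht : t ∈ K) :
    ⟪y - lse K y, t - lse K y⟫ ≤ 0 := by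
  obtain ⟨hp, hmin⟩ := isLeastSquares_lse hne hcl y
  refine (norm_eq_iInf_iff_real_inner_le_zero hco hp).1 ?_ t ht
  have : Nonempty K := hne.to_subtype
  refine le_antisymm (le_ciInf fun w => ?_)
    (ciInf_le ⟨0, by rintro _ ⟨w, rfl⟩; exact norm_nonneg _⟩ (⟨_, hp⟩ : K))
  exact (sq_le_sq₀ (norm_nonneg _) (norm_nonneg _)).1 (hmin w w.2)

/-- Firm nonexpansiveness: add the variational inequalities of the two projections, each tested at
the other. -/
lemma norm_lse_sub_sq_le_inner (hne : K.Nonempty) (hcl : IsClosed K) (hco : Convex ℝ K)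
    (y z : EuclideanSpace ℝ (Fin n)) :
    ‖lse K y - lse K z‖ ^ 2 ≤ ⟪y - z, lse K y - lse K z⟫ := by
  have h1 := inner_sub_lse_le_zero hne hcl hco y (lse_mem hne hcl z)
  have h2 := inner_sub_lse_le_zero hne hcl hco z (lse_mem hne hcl y)
  have e1 : ⟪y - lse K y, lse K z - lse K y⟫ = - ⟪y - lse K y, lse K y - lse K z⟫ := by
    rw [← inner_neg_right, neg_sub]
  rw [← real_inner_self_eq_norm_sq]
  have e2 : ⟪y - z, lse K y - lse K z⟫ = ⟪y - lse K y, lse K y - lse K z⟫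
      - ⟪z - lse K z, lse K y - lse K z⟫ + ⟪lse K y - lse K z, lse K y - lse K z⟫ := by
    rw [← inner_sub_left, ← inner_add_left]
    congr 1
    abel
  linarith

lemma norm_lse_sub_le (hne : K.Nonempty) (hcl : IsClosed K) (hco : Convex ℝ K)
    (y z : EuclideanSpace ℝ (Fin n)) : ‖lse K y - lse K z‖ ≤ ‖y - z‖ := by
  have h1 := norm_lse_sub_sq_le_inner hne hcl hco y z
  have h2 := real_inner_le_norm (y - z) (lse K y - lse K z)
  by_contra! h
  nlinarith [norm_nonneg (y - z)]

lemma continuous_lse (hne : K.Nonempty) (hcl : IsClosed K) (hco : Convex ℝ K) :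
    Continuous (lse K) := by
  refine (LipschitzWith.of_dist_le_mul (K := 1) fun y z => ?_).continuous
  simpa [dist_eq_norm] using norm_lse_sub_le hne hcl hco y z

lemma lse_eq_self (hne : K.Nonempty) (hcl : IsClosed K) {μ : EuclideanSpace ℝ (Fin n)}
    (hμ : μ ∈ K) : lse K μ = μ := by
  have h := (isLeastSquares_lse hne hcl μ).2 μ hμ
  simp only [sub_self, norm_zero] at h
  have h' : ‖μ - lse K μ‖ = 0 := by nlinarith [norm_nonneg (μ - lse K μ)]
  exact (sub_eq_zero.1 (norm_eq_zero.1 h')).symm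

end LeastSquares

/-! ### The local supremum and its mean, the local width. -/

section LocalSup

variable {n : ℕ} {K : Set (EuclideanSpace ℝ (Fin n))} {μ : EuclideanSpace ℝ (Fin n)} {ε : ℝ}

/-- `sup ⟪x, t - μ⟫` over `t ∈ B(μ, ε) ∩ K`. -/
noncomputable def localSup (K : Set (EuclideanSpace ℝ (Fin n))) (μ : EuclideanSpace ℝ (Fin n))
    (x : EuclideanSpace ℝ (Fin n)) (ε : ℝ) : ℝ :=
  (⨆ t : (closedBall μ ε ∩ K : Set (EuclideanSpace ℝ (Fin n))),
    ⟪x, (t : EuclideanSpace ℝ (Fin n))⟫) - ⟪x, μ⟫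

lemma mem_closedBall_inter_self (hμ : μ ∈ K) (hε : 0 ≤ ε) : μ ∈ closedBall μ ε ∩ K :=
  ⟨mem_closedBall_self hε, hμ⟩

lemma exists_isMaxOn_localSup (hcl : IsClosed K) (hμ : μ ∈ K)
    (hε : 0 ≤ ε) (x : EuclideanSpace ℝ (Fin n)) :
    ∃ t ∈ closedBall μ ε ∩ K, localSup K μ x ε = ⟪x, t - μ⟫ ∧
      ∀ s ∈ closedBall μ ε ∩ K, ⟪x, s - μ⟫ ≤ ⟪x, t - μ⟫ := by
  obtain ⟨t, ht, hmax⟩ := ((isCompact_closedBall μ ε).inter_right hcl).exists_isMaxOn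
    ⟨μ, mem_closedBall_inter_self hμ hε⟩
    (f := fun t => ⟪x, t⟫) (by fun_prop)
  have hmax' : ∀ s ∈ closedBall μ ε ∩ K, ⟪x, s⟫ ≤ ⟪x, t⟫ := fun s hs => hmax hs
  refine ⟨t, ht, ?_, fun s hs => ?_⟩
  · rw [localSup, inner_sub_right]
    congr 1
    have : Nonempty (closedBall μ ε ∩ K : Set (EuclideanSpace ℝ (Fin n))) := ⟨⟨t, ht⟩⟩
    exact le_antisymm (ciSup_le fun s => hmax' s s.2)
      (le_ciSup (f := fun s : (closedBall μ ε ∩ K : Set (EuclideanSpace ℝ (Fin n))) =>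
        ⟪x, (s : EuclideanSpace ℝ (Fin n))⟫)
        ⟨⟪x, t⟫, by rintro _ ⟨s, rfl⟩; exact hmax' s s.2⟩ ⟨t, ht⟩)
  · rw [inner_sub_right, inner_sub_right]
    linarith [hmax' s hs]

lemma inner_sub_le_localSup (hcl : IsClosed K) (hμ : μ ∈ K)
    (x : EuclideanSpace ℝ (Fin n)) {t : EuclideanSpace ℝ (Fin n)} (ht : ‖t - μ‖ ≤ ε)
    (htK : t ∈ K) : ⟪x, t - μ⟫ ≤ localSup K μ x ε := by
  obtain ⟨s, -, hs, hmax⟩ := exists_isMaxOn_localSup hcl hμ ((norm_nonneg _).trans ht) x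
  rw [hs]
  exact hmax t ⟨by rwa [mem_closedBall, dist_eq_norm], htK⟩

lemma exists_localSup_eq (hcl : IsClosed K) (hμ : μ ∈ K) (hε : 0 ≤ ε)
    (x : EuclideanSpace ℝ (Fin n)) :
    ∃ t ∈ K, ‖t - μ‖ ≤ ε ∧ localSup K μ x ε = ⟪x, t - μ⟫ := by
  obtain ⟨t, ht, h, -⟩ := exists_isMaxOn_localSup hcl hμ hε x
  exact ⟨t, ht.2, by rw [← dist_eq_norm]; exact ht.1, h⟩

lemma localSup_nonneg (hcl : IsClosed K) (hμ : μ ∈ K) (hε : 0 ≤ ε)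
    (x : EuclideanSpace ℝ (Fin n)) : 0 ≤ localSup K μ x ε := by
  simpa using inner_sub_le_localSup hcl hμ x (t := μ) (ε := ε) (by simpa using hε) hμ

lemma localSup_le (hcl : IsClosed K) (hμ : μ ∈ K) (hε : 0 ≤ ε)
    (x : EuclideanSpace ℝ (Fin n)) : localSup K μ x ε ≤ ε * ‖x‖ := by
  obtain ⟨t, -, ht, h⟩ := exists_localSup_eq hcl hμ hε x
  rw [h, mul_comm]
  exact (real_inner_le_norm _ _).trans (by gcongr)

lemma localSup_zero (hcl : IsClosed K) (hμ : μ ∈ K) (x : EuclideanSpace ℝ (Fin n)) :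
    localSup K μ x 0 = 0 :=
  le_antisymm (by simpa using localSup_le hcl hμ le_rfl x) (localSup_nonneg hcl hμ le_rfl x)

lemma localSup_mono (hcl : IsClosed K) (hμ : μ ∈ K) (x : EuclideanSpace ℝ (Fin n)) :
    MonotoneOn (localSup K μ x) (Set.Ici 0) := by
  intro a ha b _ hab
  obtain ⟨t, htK, ht, h⟩ := exists_localSup_eq hcl hμ ha x
  rw [h]
  exact inner_sub_le_localSup hcl hμ x (ht.trans hab) htK

/-- A convex combination of maximizers for two radii is feasible for the combined radius. -/
lemma concaveOn_localSup (hcl : IsClosed K) (hco : Convex ℝ K) (hμ : μ ∈ K)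
    (x : EuclideanSpace ℝ (Fin n)) : ConcaveOn ℝ (Set.Ici 0) (localSup K μ x) := by
  refine ⟨convex_Ici 0, fun a ha b hb p q hp hq hpq => ?_⟩
  obtain ⟨t, htK, ht, h⟩ := exists_localSup_eq hcl hμ ha x
  obtain ⟨s, hsK, hs, h'⟩ := exists_localSup_eq hcl hμ hb x
  have e : p • t + q • s - μ = p • (t - μ) + q • (s - μ) := by
    have : μ = p • μ + q • μ := by rw [← add_smul, hpq, one_smul]
    nth_rw 1 [this]
    module
  rw [h, h', smul_eq_mul, smul_eq_mul, ← real_inner_smul_right, ← real_inner_smul_right,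
    ← inner_add_right, ← e]
  refine inner_sub_le_localSup hcl hμ x ?_ (hco htK hsK hp hq hpq)
  rw [e]
  refine (norm_add_le _ _).trans ?_
  rw [norm_smul, norm_smul, Real.norm_of_nonneg hp, Real.norm_of_nonneg hq, smul_eq_mul,
    smul_eq_mul]
  gcongr

lemma localSup_sub_le (hcl : IsClosed K) (hμ : μ ∈ K) (hε : 0 ≤ ε)
    (x y : EuclideanSpace ℝ (Fin n)) :
    localSup K μ x ε - localSup K μ y ε ≤ ε * ‖x - y‖ := by
  obtain ⟨t, htK, ht, h⟩ := exists_localSup_eq hcl hμ hε x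
  have h1 := inner_sub_le_localSup hcl hμ y ht htK
  have h2 : ⟪x - y, t - μ⟫ ≤ ε * ‖x - y‖ := by
    rw [mul_comm]
    exact (real_inner_le_norm _ _).trans (by gcongr)
  rw [inner_sub_left] at h2
  linarith

lemma continuous_localSup (hcl : IsClosed K) (hμ : μ ∈ K) (hε : 0 ≤ ε) :
    Continuous fun x => localSup K μ x ε := by
  refine (LipschitzWith.of_le_add_mul ⟨ε, hε⟩ fun x y => ?_).continuous
  have := localSup_sub_le hcl hμ hε x y
  rw [dist_eq_norm]
  change _ ≤ _ + ε * ‖x - y‖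
  linarith

lemma integrable_localSup (hcl : IsClosed K) (hμ : μ ∈ K) (hε : 0 ≤ ε) :
    Integrable (fun x => localSup K μ x ε) (stdGaussian (EuclideanSpace ℝ (Fin n))) := by
  refine integrable_of_quadratic_growth (continuous_localSup hcl hμ hε) ε ε fun x => ?_
  rw [abs_of_nonneg (localSup_nonneg hcl hμ hε x)]
  nlinarith [localSup_le hcl hμ hε x, sq_nonneg (‖x‖ - 1), norm_nonneg x]

/-- Recentring at `μ` subtracts `⟪x, μ⟫`, which has mean zero. -/
lemma localWidth_eq_integral (hcl : IsClosed K) (hμ : μ ∈ K) (hε : 0 ≤ ε) :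
    localWidth K μ ε = ∫ x, localSup K μ x ε ∂(stdGaussian (EuclideanSpace ℝ (Fin n))) := by
  have hin : Integrable (fun x => ⟪x, μ⟫) (stdGaussian (EuclideanSpace ℝ (Fin n))) := by
    refine integrable_of_quadratic_growth (by fun_prop) ‖μ‖ ‖μ‖ fun x => ?_
    have := abs_real_inner_le_norm x μ
    nlinarith [sq_nonneg (‖x‖ - 1), norm_nonneg x, norm_nonneg μ]
  have e : ∀ x, (⨆ t : (closedBall μ ε ∩ K : Set (EuclideanSpace ℝ (Fin n))),
      ⟪x, (t : EuclideanSpace ℝ (Fin n))⟫) = localSup K μ x ε + ⟪x, μ⟫ := fun x => by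
    rw [localSup]; ring
  rw [localWidth, gaussianWidth]
  simp_rw [e]
  rw [integral_add (integrable_localSup hcl hμ hε) hin, integral_inner_stdGaussian, add_zero]

lemma localWidth_nonneg (hcl : IsClosed K) (hμ : μ ∈ K) (hε : 0 ≤ ε) :
    0 ≤ localWidth K μ ε := by
  rw [localWidth_eq_integral hcl hμ hε]
  exact integral_nonneg fun x => localSup_nonneg hcl hμ hε x

/-- A crude bound; its role is to make the suprema defining `widthRate` bounded. -/
lemma localWidth_le (hcl : IsClosed K) (hμ : μ ∈ K) (hε : 0 ≤ ε) :
    localWidth K μ ε ≤ ε * (1 + n) := by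
  rw [localWidth_eq_integral hcl hμ hε]
  have hi : Integrable (fun x : EuclideanSpace ℝ (Fin n) => ε * (1 + ‖x‖ ^ 2))
      (stdGaussian (EuclideanSpace ℝ (Fin n))) :=
    ((integrable_const _).add integrable_norm_sq_stdGaussian).const_mul ε
  refine (integral_mono (integrable_localSup hcl hμ hε) hi fun x => ?_).trans_eq ?_
  · have := localSup_le hcl hμ hε x
    have h2 : ‖x‖ ≤ 1 + ‖x‖ ^ 2 := by nlinarith [sq_nonneg (‖x‖ - 1), norm_nonneg x]
    exact this.trans (by gcongr)
  · rw [integral_const_mul, integral_add (integrable_const _) integrable_norm_sq_stdGaussian,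
      integral_norm_sq_stdGaussian]
    simp

lemma localWidth_mono (hcl : IsClosed K) (hμ : μ ∈ K) :
    MonotoneOn (localWidth K μ) (Set.Ici 0) := by
  intro a ha b hb hab
  rw [localWidth_eq_integral hcl hμ ha, localWidth_eq_integral hcl hμ hb]
  exact integral_mono (integrable_localSup hcl hμ ha) (integrable_localSup hcl hμ hb)
    fun x => localSup_mono hcl hμ x ha hb hab

lemma concaveOn_localWidth (hcl : IsClosed K) (hco : Convex ℝ K) (hμ : μ ∈ K) :
    ConcaveOn ℝ (Set.Ici 0) (localWidth K μ) := by
  refine ⟨convex_Ici 0, fun a ha b hb p q hp hq hpq => ?_⟩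
  have hab := convex_Ici (0 : ℝ) ha hb hp hq hpq
  rw [localWidth_eq_integral hcl hμ ha, localWidth_eq_integral hcl hμ hb,
    localWidth_eq_integral hcl hμ hab, smul_eq_mul, smul_eq_mul, ← integral_const_mul,
    ← integral_const_mul, ← integral_add ((integrable_localSup hcl hμ ha).const_mul p)
      ((integrable_localSup hcl hμ hb).const_mul q)]
  exact integral_mono (((integrable_localSup hcl hμ ha).const_mul p).add
    ((integrable_localSup hcl hμ hb).const_mul q)) (integrable_localSup hcl hμ hab)
    fun x => (concaveOn_localSup hcl hco hμ x).2 ha hb hp hq hpq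

/-- `B(μ, ε)` lies in `B(ν, 2ε)`. This trades the two base points in the definition of `widthRate`
for one. -/
lemma localWidth_le_of_mem_closedBall (hcl : IsClosed K) {ν : EuclideanSpace ℝ (Fin n)}
    (hμ : μ ∈ K) (hν : ν ∈ closedBall μ ε ∩ K) (hε : 0 ≤ ε) :
    localWidth K μ ε ≤ localWidth K ν (2 * ε) := by
  have h2 : 0 ≤ 2 * ε := by linarith
  have hin : Integrable (fun x => ⟪x, μ - ν⟫) (stdGaussian (EuclideanSpace ℝ (Fin n))) := by
    refine integrable_of_quadratic_growth (by fun_prop) ‖μ - ν‖ ‖μ - ν‖ fun x => ?_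
    have := abs_real_inner_le_norm x (μ - ν)
    nlinarith [sq_nonneg (‖x‖ - 1), norm_nonneg x, norm_nonneg (μ - ν)]
  have key : ∀ x, localSup K μ x ε + ⟪x, μ - ν⟫ ≤ localSup K ν x (2 * ε) := by
    intro x
    obtain ⟨t, htK, ht, h⟩ := exists_localSup_eq hcl hμ hε x
    rw [h, ← inner_add_right, sub_add_sub_cancel]
    refine inner_sub_le_localSup hcl hν.2 x ?_ htK
    have h1 : ‖μ - ν‖ ≤ ε := by rw [← dist_eq_norm, dist_comm]; exact hν.1
    calc ‖t - ν‖ = ‖(t - μ) + (μ - ν)‖ := by rw [sub_add_sub_cancel]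
      _ ≤ 2 * ε := (norm_add_le _ _).trans (by linarith)
  have := integral_mono ((integrable_localSup hcl hμ hε).add hin)
    (integrable_localSup hcl hν.2 h2) key
  simp only [Pi.add_apply] at this
  rw [integral_add (integrable_localSup hcl hμ hε) hin, integral_inner_stdGaussian,
    ← localWidth_eq_integral hcl hμ hε, ← localWidth_eq_integral hcl hν.2 h2] at this
  linarith

end LocalSup

/-! ### Variance of the local supremum. -/

section Deviation

variable {n : ℕ} {K : Set (EuclideanSpace ℝ (Fin n))} {μ : EuclideanSpace ℝ (Fin n)}

/-- The deviation of `localSup` from its mean `localWidth`. -/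
noncomputable def widthDeviation (K : Set (EuclideanSpace ℝ (Fin n)))
    (μ x : EuclideanSpace ℝ (Fin n)) (ε : ℝ) : ℝ :=
  localSup K μ x ε - localWidth K μ ε

lemma continuous_widthDeviation (hcl : IsClosed K) (hμ : μ ∈ K) {ε : ℝ} (hε : 0 ≤ ε) :
    Continuous fun x => widthDeviation K μ x ε :=
  (continuous_localSup hcl hμ hε).sub continuous_const

lemma integrable_widthDeviation_sq (hcl : IsClosed K) (hμ : μ ∈ K) {ε : ℝ} (hε : 0 ≤ ε) :
    Integrable (fun x => widthDeviation K μ x ε ^ 2)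
      (stdGaussian (EuclideanSpace ℝ (Fin n))) := by
  refine integrable_of_quadratic_growth ((continuous_widthDeviation hcl hμ hε).pow 2)
    (2 * localWidth K μ ε ^ 2) (2 * ε ^ 2) fun x => ?_
  rw [abs_of_nonneg (sq_nonneg _), widthDeviation]
  have h1 := pow_le_pow_left₀ (localSup_nonneg hcl hμ hε x) (localSup_le hcl hμ hε x) 2
  nlinarith [sq_nonneg (localSup K μ x ε + localWidth K μ ε)]

/-- The supremum need not be differentiable. Penalizing by `‖s - μ‖ ^ 2 / (2 * ε)` changes it by at
most `ε / 2` and makes the maximizer a projection, hence a continuous gradient to which the Poincaré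
inequality applies. -/
lemma integral_widthDeviation_sq_le (hcl : IsClosed K) (hco : Convex ℝ K) (hμ : μ ∈ K)
    {ε : ℝ} (hε : 0 < ε) :
    ∫ x, widthDeviation K μ x ε ^ 2 ∂(stdGaussian (EuclideanSpace ℝ (Fin n)))
      ≤ 33 * ε ^ 2 := by
  set γ := stdGaussian (EuclideanSpace ℝ (Fin n))
  set T := closedBall μ ε ∩ K
  have hT : T.Nonempty := ⟨μ, mem_closedBall_inter_self hμ hε.le⟩
  have hTcl : IsClosed T := isClosed_closedBall.inter hcl
  have hTco : Convex ℝ T := (convex_closedBall μ ε).inter hco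
  -- the gradient of the regularized supremum `f`
  let t : EuclideanSpace ℝ (Fin n) → EuclideanSpace ℝ (Fin n) := fun x => lse T (μ + ε • x) - μ
  have ht : Continuous t :=
    ((continuous_lse hT hTcl hTco).comp (by fun_prop)).sub continuous_const
  have htT : ∀ x, lse T (μ + ε • x) ∈ T := fun x => lse_mem hT hTcl _
  have hb : ∀ x, ‖t x‖ ≤ ε := fun x => by
    have := (htT x).1
    rwa [mem_closedBall, dist_eq_norm] at this
  let f : EuclideanSpace ℝ (Fin n) → ℝ := fun x => ⟪x, t x⟫ - ‖t x‖ ^ 2 / (2 * ε)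
  have hfc : Continuous f := by fun_prop
  have hopt : ∀ x, ∀ s ∈ T, ⟪x, s - μ⟫ - ‖s - μ‖ ^ 2 / (2 * ε) ≤ f x := by
    intro x s hs
    have h := (isLeastSquares_lse hT hTcl (μ + ε • x)).2 s hs
    have e1 : μ + ε • x - lse T (μ + ε • x) = ε • x - t x := by simp only [t]; abel
    have e2 : μ + ε • x - s = ε • x - (s - μ) := by abel
    rw [e1, e2, norm_sub_sq_real (ε • x) (t x), norm_sub_sq_real (ε • x) (s - μ), real_inner_smul_left,
      real_inner_smul_left] at h
    simp only [f]
    have h' : 2 * ε * (⟪x, s - μ⟫ - ‖s - μ‖ ^ 2 / (2 * ε)) ≤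
        2 * ε * (⟪x, t x⟫ - ‖t x‖ ^ 2 / (2 * ε)) := by
      rw [mul_sub, mul_sub, mul_div_cancel₀ _ (by positivity), mul_div_cancel₀ _ (by positivity)]
      linarith
    exact le_of_mul_le_mul_left h' (by positivity)
  have hsub : ∀ x y, f x - f y ≤ ⟪t x, x - y⟫ := by
    intro x y
    have := hopt y _ (htT x)
    change ⟪y, t x⟫ - ‖t x‖ ^ 2 / (2 * ε) ≤ f y at this
    rw [real_inner_comm, inner_sub_left]
    simp only [f] at *
    linarith
  have hvar := integral_sub_integral_sq_le ht hb hsub hfc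
  have hle : ∀ x, f x ≤ localSup K μ x ε := fun x => by
    have h1 := inner_sub_le_localSup hcl hμ x (hb x) (htT x).2
    have h2 : 0 ≤ ‖t x‖ ^ 2 / (2 * ε) := by positivity
    simp only [f]
    change ⟪x, t x⟫ ≤ _ at h1
    linarith
  have hge : ∀ x, localSup K μ x ε ≤ f x + ε / 2 := fun x => by
    obtain ⟨s, hsK, hs, h⟩ := exists_localSup_eq hcl hμ hε.le x
    have h1 := hopt x s ⟨by rwa [mem_closedBall, dist_eq_norm], hsK⟩
    have h2 : ‖s - μ‖ ^ 2 / (2 * ε) ≤ ε / 2 := by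
      rw [div_le_iff₀ (by positivity)]
      nlinarith [norm_nonneg (s - μ)]
    linarith
  have hgi := integrable_localSup hcl hμ hε.le
  have hfb : ∀ x, |f x| ≤ ε + ε / 2 + ε * ‖x‖ ^ 2 := fun x => by
    have h0 := localSup_nonneg hcl hμ hε.le x
    have h1 := localSup_le hcl hμ hε.le x
    have h2 : ε * ‖x‖ ≤ ε + ε * ‖x‖ ^ 2 := by nlinarith [sq_nonneg (‖x‖ - 1), norm_nonneg x]
    rw [abs_le]
    constructor
    · linarith [hge x, mul_nonneg hε.le (sq_nonneg ‖x‖)]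
    · linarith [hle x]
  have hfi : Integrable f γ := integrable_of_quadratic_growth hfc _ _ hfb
  set m := ∫ y, f y ∂γ
  have hm1 : m ≤ localWidth K μ ε := by
    rw [localWidth_eq_integral hcl hμ hε.le]
    exact integral_mono hfi hgi hle
  have hm2 : localWidth K μ ε ≤ m + ε / 2 := by
    rw [localWidth_eq_integral hcl hμ hε.le]
    refine (integral_mono hgi (hfi.add (integrable_const (ε / 2))) hge).trans_eq ?_
    rw [integral_add' hfi (integrable_const _)]
    simp [m]
  have hfi2 : Integrable (fun x => (f x - m) ^ 2) γ := by
    have := integrable_widthDeviation_sq hcl hμ hε.le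
    refine Integrable.mono' ((this.const_mul 2).add (integrable_const (ε ^ 2 / 2)))
      (by fun_prop) (Filter.Eventually.of_forall fun x => ?_)
    rw [Real.norm_of_nonneg (sq_nonneg _)]
    simp only [Pi.add_apply]
    have : |(f x - m) - widthDeviation K μ x ε| ≤ ε / 2 := by
      rw [widthDeviation, abs_le]
      constructor <;> linarith [hle x, hge x]
    have h2 := pow_le_pow_left₀ (abs_nonneg _) this 2
    rw [sq_abs] at h2
    nlinarith [sq_nonneg ((f x - m) - 2 * widthDeviation K μ x ε)]
  have hpt : ∀ x, widthDeviation K μ x ε ^ 2 ≤ 2 * (f x - m) ^ 2 + ε ^ 2 / 2 := fun x => by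
    have : |widthDeviation K μ x ε - (f x - m)| ≤ ε / 2 := by
      rw [widthDeviation, abs_le]
      constructor <;> linarith [hle x, hge x]
    have h2 := pow_le_pow_left₀ (abs_nonneg _) this 2
    rw [sq_abs] at h2
    nlinarith [sq_nonneg (widthDeviation K μ x ε - 2 * (f x - m))]
  refine (integral_mono (integrable_widthDeviation_sq hcl hμ hε.le)
    ((hfi2.const_mul 2).add (integrable_const (ε ^ 2 / 2))) hpt).trans ?_
  rw [integral_add' (hfi2.const_mul 2) (integrable_const _), integral_const_mul]
  simp only [integral_const, probReal_univ, one_smul]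
  -- The constant is `2 * 16 + 1 / 2`, rounded up to `33`.
  nlinarith [sq_nonneg ε]

lemma integrable_widthDeviation_sub_sq (hcl : IsClosed K) (hμ : μ ∈ K) {s u : ℝ} (hs : 0 ≤ s)
    (hu : 0 ≤ u) : Integrable (fun x => (widthDeviation K μ x u - widthDeviation K μ x s) ^ 2)
      (stdGaussian (EuclideanSpace ℝ (Fin n))) := by
  refine Integrable.mono' (((integrable_widthDeviation_sq hcl hμ hu).add
    (integrable_widthDeviation_sq hcl hμ hs)).const_mul 2)
    (((continuous_widthDeviation hcl hμ hu).sub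
      (continuous_widthDeviation hcl hμ hs)).pow 2).aestronglyMeasurable
    (Filter.Eventually.of_forall fun x => ?_)
  rw [Real.norm_of_nonneg (sq_nonneg _)]
  simp only [Pi.add_apply]
  nlinarith [sq_nonneg (widthDeviation K μ x u + widthDeviation K μ x s)]

lemma integral_widthDeviation_sub_sq_le (hcl : IsClosed K) (hco : Convex ℝ K) (hμ : μ ∈ K)
    {s u : ℝ} (hs : 0 < s) (hsu : s ≤ u) :
    ∫ x, (widthDeviation K μ x u - widthDeviation K μ x s) ^ 2
      ∂(stdGaussian (EuclideanSpace ℝ (Fin n))) ≤ 132 * u ^ 2 := by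
  have hu := hs.trans_le hsu
  have hi := (integrable_widthDeviation_sq hcl hμ hu.le).add
    (integrable_widthDeviation_sq hcl hμ hs.le)
  refine (integral_mono (integrable_widthDeviation_sub_sq hcl hμ hs.le hu.le) (hi.const_mul 2)
    fun x => ?_).trans ?_
  · simp only [Pi.add_apply]
    nlinarith [sq_nonneg (widthDeviation K μ x u + widthDeviation K μ x s)]
  · rw [integral_const_mul, integral_add' (integrable_widthDeviation_sq hcl hμ hu.le)
      (integrable_widthDeviation_sq hcl hμ hs.le)]
    have h1 := integral_widthDeviation_sq_le hcl hco hμ hu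
    have h2 := integral_widthDeviation_sq_le hcl hco hμ hs
    nlinarith

end Deviation

/-! ### The error compared with slopes of the local supremum. -/

section PathwiseBounds

variable {n : ℕ} {K : Set (EuclideanSpace ℝ (Fin n))} {σ : ℝ}
  {μ : EuclideanSpace ℝ (Fin n)}

/-- The error `‖μ̂ - μ‖` of the least squares estimator for the noise `ξ`. -/
noncomputable def lseError (K : Set (EuclideanSpace ℝ (Fin n))) (σ : ℝ)
    (μ ξ : EuclideanSpace ℝ (Fin n)) : ℝ :=
  ‖lse K (μ + σ • ξ) - μ‖

lemma lseError_nonneg (ξ : EuclideanSpace ℝ (Fin n)) : 0 ≤ lseError K σ μ ξ :=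
  norm_nonneg _

/-- The error is a supergradient of `σ * localSup` at itself. -/
lemma localSup_le_lseError_tangent (hcl : IsClosed K) (hco : Convex ℝ K) (hμ : μ ∈ K)
    (hσ : 0 < σ) (ξ : EuclideanSpace ℝ (Fin n)) {u : ℝ} (hu : 0 ≤ u) :
    σ * localSup K μ ξ u ≤ σ * localSup K μ ξ (lseError K σ μ ξ)
      + lseError K σ μ ξ * (u - lseError K σ μ ξ) := by
  have hne : K.Nonempty := ⟨μ, hμ⟩
  obtain ⟨t, htK, ht, h⟩ := exists_localSup_eq hcl hμ hu ξ
  have h1 := inner_sub_lse_le_zero hne hcl hco (μ + σ • ξ) htK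
  have h2 := inner_sub_le_localSup hcl hμ ξ (le_refl (lseError K σ μ ξ))
    (lse_mem hne hcl (μ + σ • ξ))
  set p := lse K (μ + σ • ξ) with hp
  have hr : lseError K σ μ ξ = ‖p - μ‖ := rfl
  have e1 : μ + σ • ξ - p = σ • ξ - (p - μ) := by abel
  have e2 : t - p = (t - μ) - (p - μ) := by abel
  rw [e1, e2, inner_sub_left, inner_sub_right _ (t - μ), inner_sub_right _ (t - μ),
    real_inner_smul_left, real_inner_smul_left, real_inner_self_eq_norm_sq] at h1
  have h3 : ⟪p - μ, t - μ⟫ ≤ ‖p - μ‖ * u :=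
    (real_inner_le_norm _ _).trans (by gcongr)
  rw [h]
  rw [hr] at h2 ⊢
  have h4 := mul_le_mul_of_nonneg_left h2 hσ.le
  nlinarith

/-- By concavity the slope over `[s, u]` is at least the slope over `[u, r]`, which the tangent
inequality bounds below by `r / σ`. The next lemma is the mirror image for `r < s`. -/
lemma lseError_mul_le (hcl : IsClosed K) (hco : Convex ℝ K) (hμ : μ ∈ K)
    (hσ : 0 < σ) (ξ : EuclideanSpace ℝ (Fin n)) {s u : ℝ} (hs : 0 ≤ s) (hsu : s < u)
    (hr : u < lseError K σ μ ξ) :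
    lseError K σ μ ξ * (u - s) ≤ σ * (localSup K μ ξ u - localSup K μ ξ s) := by
  have hu := hs.trans hsu.le
  have h1 := localSup_le_lseError_tangent hcl hco hμ hσ ξ hu
  have h2 := (concaveOn_localSup hcl hco hμ ξ).slope_anti_adjacent (x := s) (y := u) hs
    (hu.trans hr.le) hsu hr
  have h3 : lseError K σ μ ξ ≤
      σ * ((localSup K μ ξ (lseError K σ μ ξ) - localSup K μ ξ u) / (lseError K σ μ ξ - u)) := by
    rw [← mul_div_assoc, le_div_iff₀ (sub_pos.2 hr)]
    linarith
  have h4 := h3.trans (mul_le_mul_of_nonneg_left h2 hσ.le)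
  rwa [← mul_div_assoc, le_div_iff₀ (sub_pos.2 hsu)] at h4

lemma le_lseError_mul (hcl : IsClosed K) (hco : Convex ℝ K) (hμ : μ ∈ K)
    (hσ : 0 < σ) (ξ : EuclideanSpace ℝ (Fin n)) {s u : ℝ} (hsu : s < u)
    (hr : lseError K σ μ ξ < s) :
    σ * (localSup K μ ξ u - localSup K μ ξ s) ≤ lseError K σ μ ξ * (u - s) := by
  have hr0 := lseError_nonneg (K := K) (σ := σ) (μ := μ) ξ
  have hs := hr0.trans hr.le
  have h1 := localSup_le_lseError_tangent hcl hco hμ hσ ξ hs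
  have h2 := (concaveOn_localSup hcl hco hμ ξ).slope_anti_adjacent (z := u) (y := s) hr0
    (hs.trans hsu.le) hr hsu
  have h3 : σ * ((localSup K μ ξ s - localSup K μ ξ (lseError K σ μ ξ)) /
      (s - lseError K σ μ ξ)) ≤ lseError K σ μ ξ := by
    rw [← mul_div_assoc, div_le_iff₀ (sub_pos.2 hr)]
    linarith
  have h4 := (mul_le_mul_of_nonneg_left h2 hσ.le).trans h3
  rwa [← mul_div_assoc, div_le_iff₀ (sub_pos.2 hsu)] at h4

lemma lseError_le (hcl : IsClosed K) (hco : Convex ℝ K) (hμ : μ ∈ K) (hσ : 0 < σ)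
    (ξ : EuclideanSpace ℝ (Fin n)) : lseError K σ μ ξ ≤ σ * ‖ξ‖ := by
  have h := norm_lse_sub_le ⟨μ, hμ⟩ hcl hco (μ + σ • ξ) μ
  rw [lse_eq_self ⟨μ, hμ⟩ hcl hμ, add_sub_cancel_left, norm_smul, Real.norm_of_nonneg hσ.le] at h
  exact h

lemma continuous_lseError (hcl : IsClosed K) (hco : Convex ℝ K) (hμ : μ ∈ K) :
    Continuous (lseError K σ μ) :=
  (((continuous_lse ⟨μ, hμ⟩ hcl hco).comp (by fun_prop)).sub continuous_const).norm

lemma integrable_lseError_sq (hcl : IsClosed K) (hco : Convex ℝ K) (hμ : μ ∈ K) (hσ : 0 < σ) :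
    Integrable (fun ξ => lseError K σ μ ξ ^ 2) (stdGaussian (EuclideanSpace ℝ (Fin n))) := by
  refine integrable_of_quadratic_growth ((continuous_lseError hcl hco hμ).pow 2) 0 (σ ^ 2)
    fun ξ => ?_
  rw [abs_of_nonneg (sq_nonneg _), zero_add, ← mul_pow]
  exact pow_le_pow_left₀ (lseError_nonneg ξ) (lseError_le hcl hco hμ hσ ξ) 2

lemma lseRisk_nonneg : 0 ≤ lseRisk K σ μ :=
  integral_nonneg fun _ => sq_nonneg _

/-- Needed only for the boundedness of the supremum in `worstCaseRate`. -/
lemma lseRisk_le (hcl : IsClosed K) (hco : Convex ℝ K) (hμ : μ ∈ K) (hσ : 0 < σ) :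
    lseRisk K σ μ ≤ σ ^ 2 * n := by
  rw [← integral_norm_sq_stdGaussian, ← integral_const_mul]
  refine integral_mono (integrable_lseError_sq hcl hco hμ hσ)
    (integrable_norm_sq_stdGaussian.const_mul _) fun ξ => ?_
  rw [← mul_pow]
  exact pow_le_pow_left₀ (lseError_nonneg ξ) (lseError_le hcl hco hμ hσ ξ) 2

lemma lseRisk_le_worstCaseRate_sq (hcl : IsClosed K) (hco : Convex ℝ K) (hμ : μ ∈ K)
    (hσ : 0 < σ) : lseRisk K σ μ ≤ worstCaseRate K σ ^ 2 := by
  have hnn : 0 ≤ ⨆ μ : K, lseRisk K σ μ := Real.iSup_nonneg fun _ => lseRisk_nonneg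
  rw [worstCaseRate, Real.sq_sqrt hnn]
  exact le_ciSup (f := fun μ : K => lseRisk K σ μ)
    ⟨σ ^ 2 * n, by rintro _ ⟨ν, rfl⟩; exact lseRisk_le hcl hco ν.2 hσ⟩ ⟨μ, hμ⟩

lemma worstCaseRate_nonneg : 0 ≤ worstCaseRate K σ := Real.sqrt_nonneg _

lemma worstCaseRate_sq_le (hne : K.Nonempty) {B : ℝ} (h : ∀ μ ∈ K, lseRisk K σ μ ≤ B) :
    worstCaseRate K σ ^ 2 ≤ B := by
  have hnn : 0 ≤ ⨆ μ : K, lseRisk K σ μ := Real.iSup_nonneg fun _ => lseRisk_nonneg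
  have := hne.to_subtype
  rw [worstCaseRate, Real.sq_sqrt hnn]
  exact ciSup_le fun μ => h μ μ.2

end PathwiseBounds

/-! ### Risk bounds from slopes of the local width. -/

section RiskBounds

variable {n : ℕ} {K : Set (EuclideanSpace ℝ (Fin n))} {σ : ℝ}
  {μ : EuclideanSpace ℝ (Fin n)}

/-- An upper bound on the risk from a bound on the slope of the local width. -/
lemma lseRisk_le_of_slope_le (hcl : IsClosed K) (hco : Convex ℝ K) (hμ : μ ∈ K) (hσ : 0 < σ)
    {s u B q : ℝ} (hs : 0 < s) (hsu : s < u) (huB : u ≤ B)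
    (hw : σ * (localWidth K μ u - localWidth K μ s) ≤ B * (u - s)) (hq0 : 0 < q) (hq1 : q < 1) :
    lseRisk K σ μ ≤ B ^ 2 / q + 132 * (σ * u / (u - s)) ^ 2 / (1 - q) := by
  have hus := sub_pos.2 hsu
  have hq1' := sub_pos.2 hq1
  have hpt : ∀ ξ, lseError K σ μ ξ ^ 2 ≤ B ^ 2 / q + (σ / (u - s)) ^ 2 / (1 - q) *
      (widthDeviation K μ ξ u - widthDeviation K μ ξ s) ^ 2 := by
    intro ξ
    set r := lseError K σ μ ξ
    set D := widthDeviation K μ ξ u - widthDeviation K μ ξ s with hD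
    have hr0 : 0 ≤ r := lseError_nonneg ξ
    have hB0 : 0 < B := by linarith
    have hr : r ≤ B + |σ / (u - s) * D| := by
      rcases le_or_gt r u with h | h
      · linarith [abs_nonneg (σ / (u - s) * D)]
      · have h1 := lseError_mul_le hcl hco hμ hσ ξ hs.le hsu h
        have h2 : r * (u - s) ≤ (B + σ / (u - s) * D) * (u - s) := by
          rw [add_mul, div_mul_eq_mul_div, div_mul_cancel₀ _ hus.ne']
          simp only [hD, widthDeviation]
          linarith
        linarith [le_of_mul_le_mul_right h2 hus, le_abs_self (σ / (u - s) * D)]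
    set N := |σ / (u - s) * D| with hN
    have e : (σ / (u - s)) ^ 2 / (1 - q) * D ^ 2 = N ^ 2 / (1 - q) := by
      rw [hN, sq_abs]; ring
    rw [e]
    -- Weighted Young: `(B + N) ^ 2 ≤ B ^ 2 / q + N ^ 2 / (1 - q)`.
    refine (pow_le_pow_left₀ hr0 hr 2).trans ?_
    rw [div_add_div _ _ hq0.ne' hq1'.ne', le_div_iff₀ (mul_pos hq0 hq1')]
    nlinarith [sq_nonneg ((1 - q) * B - q * N)]
  have hi := integrable_widthDeviation_sub_sq hcl hμ hs.le (hs.trans hsu).le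
  refine (integral_mono (integrable_lseError_sq hcl hco hμ hσ)
    ((integrable_const _).add (hi.const_mul _)) hpt).trans ?_
  rw [integral_add' (integrable_const _) (hi.const_mul _), integral_const_mul]
  simp only [integral_const, probReal_univ, one_smul]
  have hv := integral_widthDeviation_sub_sq_le hcl hco hμ hs hsu.le
  have e : 132 * (σ * u / (u - s)) ^ 2 / (1 - q)
      = (σ / (u - s)) ^ 2 / (1 - q) * (132 * u ^ 2) := by ring
  rw [e]
  gcongr

lemma sum_inv_succ_sq_le_two (N : ℕ) : ∑ k ∈ Finset.range N, ((k + 1 : ℝ) ^ 2)⁻¹ ≤ 2 := by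
  suffices h : ∑ k ∈ Finset.range N, ((k + 1 : ℝ) ^ 2)⁻¹ ≤ 2 - (N : ℝ)⁻¹ from
    h.trans (by simp)
  induction N with
  | zero => simp
  | succ N ih =>
    rw [Finset.sum_range_succ]
    rcases Nat.eq_zero_or_pos N with rfl | hN
    · norm_num
    · have hN' : (0 : ℝ) < N := by exact_mod_cast hN
      have : ((N + 1 : ℝ) ^ 2)⁻¹ ≤ (N : ℝ)⁻¹ - (N + 1 : ℝ)⁻¹ := by
        rw [inv_sub_inv hN'.ne' (by positivity), inv_eq_one_div,
          div_le_div_iff₀ (by positivity) (by positivity)]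
        nlinarith
      push_cast
      linarith

lemma one_le_deviation_sq {a b δ : ℝ} (hδ : 0 < δ) (h : δ ≤ σ * (a - b)) :
    1 ≤ (σ / δ) ^ 2 * (b - a) ^ 2 := by
  have h1 : 1 ≤ σ * (a - b) / δ := (one_le_div hδ).2 h
  calc (1 : ℝ) ≤ (σ * (a - b) / δ) ^ 2 := one_le_pow₀ h1
    _ = _ := by ring

/-- If `r < s`, the slope of the supremum falls short of that of the width, so the deviation must be
at least `δ / σ`. The scaled square therefore dominates the indicator of `r < s`, as in Chebyshev's
inequality. -/
lemma one_le_deviation_sq_of_lseError_lt (hcl : IsClosed K) (hco : Convex ℝ K) (hμ : μ ∈ K)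
    (hσ : 0 < σ) {ξ : EuclideanSpace ℝ (Fin n)} {s u δ : ℝ} (hsu : s < u) (hδ : 0 < δ)
    (hw : s * (u - s) + δ ≤ σ * (localWidth K μ u - localWidth K μ s))
    (hr : lseError K σ μ ξ < s) :
    1 ≤ (σ / δ) ^ 2 * (widthDeviation K μ ξ u - widthDeviation K μ ξ s) ^ 2 := by
  refine one_le_deviation_sq hδ ?_
  have h1 := le_lseError_mul hcl hco hμ hσ ξ hsu hr
  have h2 := mul_le_mul_of_nonneg_right hr.le (sub_pos.2 hsu).le
  simp only [widthDeviation]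
  linarith

lemma integral_scaled_deviation_sq_le (hcl : IsClosed K) (hco : Convex ℝ K) (hμ : μ ∈ K)
    {s u b : ℝ} (δ m : ℝ) (hs : 0 < s) (hsu : s ≤ u) (hub : u ≤ b) :
    ∫ ξ, (σ / (m * δ)) ^ 2 * (widthDeviation K μ ξ u - widthDeviation K μ ξ s) ^ 2
      ∂(stdGaussian (EuclideanSpace ℝ (Fin n))) ≤
      (σ / δ) ^ 2 * (132 * b ^ 2) * (m ^ 2)⁻¹ := by
  have hu : 0 ≤ u := (hs.trans_le hsu).le
  rw [integral_const_mul]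
  have h1 := integral_widthDeviation_sub_sq_le hcl hco hμ hs hsu
  have h2 : 132 * u ^ 2 ≤ 132 * b ^ 2 := by gcongr
  calc _ ≤ (σ / (m * δ)) ^ 2 * (132 * b ^ 2) :=
        mul_le_mul_of_nonneg_left (h1.trans h2) (sq_nonneg _)
    _ = _ := by rw [div_pow, div_pow, mul_pow]; ring

/-- `s` is the convex combination of `s'` and `s - k * (s' - s)` with weights `k / (k + 1)` and `1 /
(k + 1)`. -/
lemma mul_sub_le_sub_of_concaveOn {w : ℝ → ℝ} (hw : ConcaveOn ℝ (Set.Ici 0) w) {s s' : ℝ}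
    {k : ℕ} (hss' : s < s') (hk : 0 ≤ s - k * (s' - s)) :
    (k + 1) * (w s' - w s) ≤ w s' - w (s - k * (s' - s)) := by
  have hk1 : (0 : ℝ) ≤ k / (k + 1) := by positivity
  have hk2 : (0 : ℝ) ≤ 1 / (k + 1) := by positivity
  have hs' : 0 ≤ s' := by nlinarith [(Nat.cast_nonneg k : (0 : ℝ) ≤ k)]
  have h := hw.2 hs' hk hk1 hk2 (by field_simp)
  have e : (k / (k + 1) : ℝ) • s' + (1 / (k + 1) : ℝ) • (s - k * (s' - s)) = s := by
    simp only [smul_eq_mul]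
    field_simp
    ring
  rw [e, smul_eq_mul, smul_eq_mul, div_mul_eq_mul_div, div_mul_eq_mul_div, ← add_div,
    div_le_iff₀ (by positivity), one_mul] at h
  linarith

/-- If `X` and `Y k` dominate the indicators of `r < s + a` and of `r < s - k * a`, then
`r ^ 2` is at least `s ^ 2` up to the corresponding losses. -/
lemma sq_add_le_of_steps {s a r X : ℝ} {Y : ℕ → ℝ} (hs : 0 < s) (ha : 0 < a) (hr : 0 ≤ r)
    (hX0 : 0 ≤ X) (hY0 : ∀ k, 0 ≤ Y k) (hX : r < s + a → 1 ≤ X)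
    (hY : ∀ k < ⌈s / a⌉₊, r < s - k * a → 1 ≤ Y k) :
    s ^ 2 + 2 * s * a * (1 - X - ∑ k ∈ Finset.range ⌈s / a⌉₊, Y k) ≤ r ^ 2 := by
  set S := ∑ k ∈ Finset.range ⌈s / a⌉₊, Y k with hS
  have hS0 : 0 ≤ S := Finset.sum_nonneg fun k _ => hY0 k
  suffices h : s + a * (1 - X - S) ≤ r by
    have := mul_le_mul_of_nonneg_left h hs.le
    linarith [sq_nonneg (r - s)]
  rcases le_or_gt (s + a) r with h | h
  · have := mul_le_mul_of_nonneg_left (show 1 - X - S ≤ 1 by linarith) ha.le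
    linarith
  have hX1 := hX h
  rcases le_or_gt s r with h' | h'
  · have := mul_nonpos_of_nonneg_of_nonpos ha.le (show 1 - X - S ≤ 0 by linarith)
    linarith
  -- Exactly `⌈(s - r) / a⌉₊` indices satisfy `r < s - k * a`, and each contributes at least `1`.
  have hm : (⌈(s - r) / a⌉₊ : ℝ) ≤ S := by
    have hsub : Finset.range ⌈(s - r) / a⌉₊ ⊆ Finset.range ⌈s / a⌉₊ := by
      rw [Finset.range_subset_range]
      exact Nat.ceil_mono (by gcongr; linarith)
    refine le_trans ?_ (Finset.sum_le_sum_of_subset_of_nonneg hsub fun k _ _ => hY0 k)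
    have := Finset.card_nsmul_le_sum (Finset.range ⌈(s - r) / a⌉₊) Y 1 fun k hk => by
      refine hY k (Finset.mem_range.1 (hsub hk)) ?_
      have := Nat.lt_ceil.1 (Finset.mem_range.1 hk)
      rw [lt_div_iff₀ ha] at this
      linarith
    simpa using this
  have h1 := (Nat.le_ceil ((s - r) / a)).trans hm
  rw [div_le_iff₀ ha] at h1
  have := mul_le_mul_of_nonneg_left (show 1 - X - S ≤ - S by linarith) ha.le
  linarith

lemma exists_eq_midpoint_of_concaveOn {w : ℝ → ℝ} (hw : ConcaveOn ℝ (Set.Ici 0) w) {s u : ℝ}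
    (hs : 0 < s) (hsu : s < u) (h : w s < w u) :
    ∃ v, s < v ∧ v < u ∧ w v = (w s + w u) / 2 := by
  have hcont : ContinuousOn w (Set.Icc s u) :=
    ((hw.subset Set.Ioi_subset_Ici_self (convex_Ioi 0)).continuousOn isOpen_Ioi).mono
      fun x hx => hs.trans_le hx.1
  obtain ⟨v, hv, hmid⟩ : ∃ v ∈ Set.Icc s u, w v = (w s + w u) / 2 :=
    intermediate_value_Icc hsu.le hcont ⟨by linarith, by linarith⟩
  exact ⟨v, lt_of_le_of_ne hv.1 (by rintro rfl; linarith),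
    lt_of_le_of_ne hv.2 (by rintro rfl; linarith), hmid⟩

/-- The losses have mean at most `1 / 3 + (1 / 3) * 2 = 1`, so they do not exceed the gain and `s ^
2` survives without a constant. -/
lemma sq_le_integral_of_steps {Ω : Type*} [MeasurableSpace Ω] {γ : Measure Ω}
    [IsProbabilityMeasure γ] {f X : Ω → ℝ} {Y : ℕ → Ω → ℝ} {s b : ℝ} {N : ℕ} (hb : 0 ≤ b)
    (hf : Integrable f γ) (hXi : Integrable X γ)
    (hYi : ∀ k ∈ Finset.range N, Integrable (Y k) γ) (hX : ∫ ω, X ω ∂γ ≤ 1 / 3)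
    (hY : ∀ k ∈ Finset.range N, ∫ ω, Y k ω ∂γ ≤ 1 / 3 * ((k + 1 : ℝ) ^ 2)⁻¹)
    (hpt : ∀ ω, s ^ 2 + b * (1 - X ω - ∑ k ∈ Finset.range N, Y k ω) ≤ f ω) :
    s ^ 2 ≤ ∫ ω, f ω ∂γ := by
  have hYsum : ∫ ω, ∑ k ∈ Finset.range N, Y k ω ∂γ ≤ 2 / 3 := by
    rw [integral_finsetSum _ hYi]
    refine (Finset.sum_le_sum hY).trans ?_
    rw [← Finset.mul_sum]
    linarith [sum_inv_succ_sq_le_two N]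
  have hYsi : Integrable (fun ω => ∑ k ∈ Finset.range N, Y k ω) γ := integrable_finsetSum _ hYi
  have hi1 : Integrable (fun ω => 1 - X ω) γ := (integrable_const 1).sub hXi
  have hi2 : Integrable (fun ω => 1 - X ω - ∑ k ∈ Finset.range N, Y k ω) γ := hi1.sub hYsi
  have hmain := integral_mono ((integrable_const (s ^ 2)).add (hi2.const_mul b)) hf hpt
  rw [integral_add' (integrable_const _) (hi2.const_mul _), integral_const_mul,
    integral_sub hi1 hYsi, integral_sub (integrable_const 1) hXi] at hmain
  simp only [integral_const, probReal_univ, one_smul] at hmain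
  have : 0 ≤ b * (1 - ∫ ω, X ω ∂γ - ∫ ω, ∑ k ∈ Finset.range N, Y k ω ∂γ) :=
    mul_nonneg hb (by linarith)
  linarith

/-- A lower bound on the risk from the growth of the local width between `ε / c` and `2 * ε`. -/
lemma sq_le_lseRisk (hcl : IsClosed K) (hco : Convex ℝ K) (hμ : μ ∈ K) (hσ : 0 < σ)
    {c ε : ℝ} (hc : 1 < c) (hε : 0 < ε)
    (hw : 2 * ((1 + 1 / (2 * c)) * ε ^ 2) ≤
      σ * (localWidth K μ (2 * ε) - localWidth K μ (ε / c)))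
    (hL : 6336 * c ^ 2 * σ ^ 2 ≤ ε ^ 2) : (ε / c) ^ 2 ≤ lseRisk K σ μ := by
  set γ := stdGaussian (EuclideanSpace ℝ (Fin n))
  have hc0 : 0 < c := by linarith
  obtain ⟨s, hsdef⟩ : ∃ s, s = ε / c := ⟨_, rfl⟩
  rw [← hsdef] at hw ⊢
  have hs : 0 < s := by rw [hsdef]; positivity
  have hsε : s < 2 * ε := by
    rw [hsdef, div_lt_iff₀ hc0]; nlinarith
  have hconc := concaveOn_localWidth hcl hco hμ
  have hpos : 0 < (1 + 1 / (2 * c)) * ε ^ 2 := by positivity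
  have hwlt : localWidth K μ s < localWidth K μ (2 * ε) := by
    by_contra! h
    linarith [mul_nonpos_of_nonneg_of_nonpos hσ.le (sub_nonpos.2 h)]
  -- Half of the growth lies on each side of `s'`: the upper half makes `r ≥ s'` likely, the lower
  -- half controls how far `r` drops below `s`.
  obtain ⟨s', hss', hs'ε, hmid⟩ := exists_eq_midpoint_of_concaveOn hconc hs hsε hwlt
  have hw1 : (1 + 1 / (2 * c)) * ε ^ 2 ≤ σ * (localWidth K μ (2 * ε) - localWidth K μ s') := by
    rw [hmid]; linarith
  have hw2 : (1 + 1 / (2 * c)) * ε ^ 2 ≤ σ * (localWidth K μ s' - localWidth K μ s) := by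
    rw [hmid]; linarith
  set a := s' - s with ha
  have ha0 : 0 < a := sub_pos.2 hss'
  set N := ⌈s / a⌉₊
  have hkpos : ∀ k < N, 0 < s - k * a := fun k hk => by
    have := Nat.lt_ceil.1 hk
    rw [lt_div_iff₀ ha0] at this
    linarith
  obtain ⟨δ, hδdef⟩ : ∃ δ, δ = ε ^ 2 / (2 * c) := ⟨_, rfl⟩
  have hδ : 0 < δ := by rw [hδdef]; positivity
  have hδ' : (1 + 1 / (2 * c)) * ε ^ 2 = ε ^ 2 + δ := by rw [hδdef]; ring
  rw [hδ'] at hw1 hw2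
  let X : EuclideanSpace ℝ (Fin n) → ℝ := fun ξ =>
    (σ / δ) ^ 2 * (widthDeviation K μ ξ (2 * ε) - widthDeviation K μ ξ s') ^ 2
  let Y : ℕ → EuclideanSpace ℝ (Fin n) → ℝ := fun k ξ =>
    (σ / ((k + 1) * δ)) ^ 2 * (widthDeviation K μ ξ s' - widthDeviation K μ ξ (s - k * a)) ^ 2
  have hX : ∀ ξ, lseError K σ μ ξ < s' → 1 ≤ X ξ := by
    intro ξ hr
    refine one_le_deviation_sq_of_lseError_lt hcl hco hμ hσ hs'ε hδ (le_trans ?_ hw1) hr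
    -- `s' * (2 * ε - s') ≤ ε ^ 2`, which leaves exactly the margin `δ`.
    linarith [sq_nonneg (s' - ε)]
  have hY : ∀ k < N, ∀ ξ, lseError K σ μ ξ < s - k * a → 1 ≤ Y k ξ := by
    intro k hk ξ hr
    have hka : 0 ≤ k * a := by positivity
    refine one_le_deviation_sq_of_lseError_lt hcl hco hμ hσ (by linarith) (by positivity)
      (le_trans ?_ (mul_le_mul_of_nonneg_left
        (mul_sub_le_sub_of_concaveOn hconc hss' (hkpos k hk).le) hσ.le)) hr
    -- Concavity multiplies the growth by `k + 1`, and both the cost and the margin scale alike.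
    -- Chebyshev then yields the summable factor `1 / (k + 1) ^ 2`.
    have h1 : (s - k * a) * (s' - (s - k * a)) ≤ (k + 1) * (s * a) := by
      have e : s' - (s - k * a) = (k + 1) * a := by rw [ha]; ring
      rw [e]
      have := mul_le_mul_of_nonneg_right (show s - k * a ≤ s by linarith)
        (show 0 ≤ (k + 1) * a by positivity)
      linarith
    have h2 : s * a ≤ ε ^ 2 := by
      have := mul_le_mul_of_nonneg_left (show a ≤ 2 * ε - s by rw [ha]; linarith) hs.le
      linarith [sq_nonneg (s - ε)]
    have h3 : (k + 1) * (s * a) + (k + 1) * δ ≤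
        (k + 1) * (σ * (localWidth K μ s' - localWidth K μ s)) := by
      rw [← mul_add]
      exact mul_le_mul_of_nonneg_left (by linarith) (by positivity)
    linarith
  have hX0 : ∀ ξ, 0 ≤ X ξ := fun ξ => by positivity
  have hY0 : ∀ k ξ, 0 ≤ Y k ξ := fun k ξ => by positivity
  have hpt : ∀ ξ, s ^ 2 + 2 * s * a * (1 - X ξ - ∑ k ∈ Finset.range N, Y k ξ) ≤
      lseError K σ μ ξ ^ 2 := fun ξ =>
    sq_add_le_of_steps hs ha0 (lseError_nonneg ξ) (hX0 ξ) (fun k => hY0 k ξ)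
      (fun h => hX ξ (by linarith)) fun k hk h => hY k hk ξ h
  have hXi : Integrable X γ :=
    (integrable_widthDeviation_sub_sq hcl hμ (hs.trans hss').le (by positivity)).const_mul _
  have hYi : ∀ k ∈ Finset.range N, Integrable (Y k) γ := fun k hk =>
    (integrable_widthDeviation_sub_sq hcl hμ (hkpos k (Finset.mem_range.1 hk)).le
      (hs.trans hss').le).const_mul _
  have hη : (σ / δ) ^ 2 * (132 * (2 * ε) ^ 2) ≤ 1 / 3 := by
    have e : (σ / δ) ^ 2 * (132 * (2 * ε) ^ 2) = 2112 * c ^ 2 * σ ^ 2 / ε ^ 2 := by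
      rw [hδdef]; field_simp; ring
    rw [e, div_le_iff₀ (by positivity)]
    linarith
  have hXv : ∫ ξ, X ξ ∂γ ≤ 1 / 3 := by
    have h := integral_scaled_deviation_sq_le hcl hco hμ (σ := σ) δ 1 (hs.trans hss') hs'ε.le
      le_rfl
    rw [one_mul, one_pow, inv_one, mul_one] at h
    exact h.trans hη
  have hYv : ∀ k ∈ Finset.range N, ∫ ξ, Y k ξ ∂γ ≤ 1 / 3 * ((k + 1 : ℝ) ^ 2)⁻¹ := fun k hk =>
    have hka : 0 ≤ k * a := by positivity
    (integral_scaled_deviation_sq_le hcl hco hμ δ (k + 1) (hkpos k (Finset.mem_range.1 hk))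
      (by linarith) hs'ε.le).trans (mul_le_mul_of_nonneg_right hη (by positivity))
  exact sq_le_integral_of_steps (by positivity) (integrable_lseError_sq hcl hco hμ hσ) hXi hYi
    hXv hYv hpt

end RiskBounds

/-! ### The set of radii defining `widthRate`. -/

section WidthRate

variable {n : ℕ} {K : Set (EuclideanSpace ℝ (Fin n))} {c τ : ℝ}

/-- The set of radii of which `widthRate` is the supremum. -/
def widthRateSet (K : Set (EuclideanSpace ℝ (Fin n))) (c τ : ℝ) : Set ℝ :=
  {ε : ℝ | 0 ≤ ε ∧
    (⨆ μ : K, (localWidth K μ ε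
      - ⨅ ν : (closedBall (μ : EuclideanSpace ℝ (Fin n)) ε ∩ K :
          Set (EuclideanSpace ℝ (Fin n))), localWidth K ν (ε / c)))
      ≥ (4 + 4 / c) * (ε ^ 2 / (2 * τ))}

lemma iInf_localWidth_nonneg (hcl : IsClosed K) {ε : ℝ} (hc : 0 < c) (hε : 0 ≤ ε)
    (μ : EuclideanSpace ℝ (Fin n)) :
    0 ≤ ⨅ ν : (closedBall μ ε ∩ K : Set (EuclideanSpace ℝ (Fin n))), localWidth K ν (ε / c) :=
  Real.iInf_nonneg fun ν => localWidth_nonneg hcl ν.2.2 (by positivity)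

lemma localWidth_sub_iInf_le (hcl : IsClosed K) {ε : ℝ} (hc : 0 < c) (hε : 0 ≤ ε) (μ : K) :
    localWidth K μ ε - ⨅ ν : (closedBall (μ : EuclideanSpace ℝ (Fin n)) ε ∩ K :
      Set (EuclideanSpace ℝ (Fin n))), localWidth K ν (ε / c) ≤ ε * (1 + n) := by
  have := iInf_localWidth_nonneg hcl hc hε (μ : EuclideanSpace ℝ (Fin n))
  linarith [localWidth_le hcl μ.2 hε]

lemma zero_mem_widthRateSet (hcl : IsClosed K) :
    (0 : ℝ) ∈ widthRateSet K c τ := by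
  refine ⟨le_rfl, ?_⟩
  have h0 : (4 + 4 / c) * ((0 : ℝ) ^ 2 / (2 * τ)) = 0 := by simp
  rw [h0]
  refine Real.iSup_nonneg fun μ => ?_
  have hle : ⨅ ν : (closedBall (μ : EuclideanSpace ℝ (Fin n)) 0 ∩ K :
      Set (EuclideanSpace ℝ (Fin n))), localWidth K ν (0 / c) ≤ localWidth K μ (0 / c) :=
    ciInf_le (f := fun ν : (closedBall (μ : EuclideanSpace ℝ (Fin n)) 0 ∩ K :
      Set (EuclideanSpace ℝ (Fin n))) => localWidth K ν (0 / c))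
      ⟨0, by rintro _ ⟨ν, rfl⟩; exact localWidth_nonneg hcl ν.2.2 (by simp)⟩
      ⟨μ, mem_closedBall_inter_self μ.2 le_rfl⟩
  rw [zero_div] at hle ⊢
  linarith

/-- The threshold is quadratic in `ε` while the widths grow at most linearly. Without boundedness
the real `sSup` would take the default value `0`. -/
lemma bddAbove_widthRateSet (hcl : IsClosed K) (hc : 0 < c) (hτ : 0 < τ) :
    BddAbove (widthRateSet K c τ) := by
  refine ⟨τ * (1 + n), fun ε hε => ?_⟩
  obtain ⟨hε0, h⟩ := hε
  have hle : (⨆ μ : K, (localWidth K μ ε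
      - ⨅ ν : (closedBall (μ : EuclideanSpace ℝ (Fin n)) ε ∩ K :
          Set (EuclideanSpace ℝ (Fin n))), localWidth K ν (ε / c))) ≤ ε * (1 + n) :=
    Real.iSup_le (fun μ => localWidth_sub_iInf_le hcl hc hε0 μ) (by positivity)
  have h1 := h.le.trans hle
  have h2 : 0 ≤ 4 / c := by positivity
  rw [← mul_div_assoc, div_le_iff₀ (by positivity)] at h1
  by_contra! hlt
  have hεpos : 0 < ε := lt_of_le_of_lt (by positivity) hlt
  nlinarith [mul_pos hεpos (sub_pos.2 hlt), mul_nonneg h2 (sq_nonneg ε)]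

lemma localWidth_sub_lt_of_widthRate_lt (hcl : IsClosed K) (hc : 0 < c) (hτ : 0 < τ) {ε : ℝ}
    (hε0 : 0 ≤ ε) (hε : widthRate K c τ < ε) {μ : EuclideanSpace ℝ (Fin n)} (hμ : μ ∈ K) :
    localWidth K μ ε - localWidth K μ (ε / c) < (4 + 4 / c) * (ε ^ 2 / (2 * τ)) := by
  have hnot : ε ∉ widthRateSet K c τ := fun h =>
    hε.not_ge (le_csSup (bddAbove_widthRateSet hcl hc hτ) h)
  have hlt : (⨆ μ : K, (localWidth K μ ε
      - ⨅ ν : (closedBall (μ : EuclideanSpace ℝ (Fin n)) ε ∩ K :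
          Set (EuclideanSpace ℝ (Fin n))), localWidth K ν (ε / c)))
      < (4 + 4 / c) * (ε ^ 2 / (2 * τ)) := by
    by_contra! h
    exact hnot ⟨hε0, h⟩
  have h1 : localWidth K μ ε - ⨅ ν : (closedBall μ ε ∩ K : Set (EuclideanSpace ℝ (Fin n))),
      localWidth K ν (ε / c) ≤ _ :=
    le_ciSup (f := fun μ : K => localWidth K μ ε
      - ⨅ ν : (closedBall (μ : EuclideanSpace ℝ (Fin n)) ε ∩ K :
          Set (EuclideanSpace ℝ (Fin n))), localWidth K ν (ε / c))
      ⟨ε * (1 + n), by rintro _ ⟨ν, rfl⟩; exact localWidth_sub_iInf_le hcl hc hε0 ν⟩ ⟨μ, hμ⟩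
  have h2 : ⨅ ν : (closedBall μ ε ∩ K : Set (EuclideanSpace ℝ (Fin n))),
      localWidth K ν (ε / c) ≤ localWidth K μ (ε / c) :=
    ciInf_le (f := fun ν : (closedBall μ ε ∩ K :
      Set (EuclideanSpace ℝ (Fin n))) => localWidth K ν (ε / c))
      ⟨0, by rintro _ ⟨ν, rfl⟩; exact localWidth_nonneg hcl ν.2.2 (by positivity)⟩
      ⟨μ, mem_closedBall_inter_self hμ hε0⟩
  linarith

lemma exists_lt_of_mem_widthRateSet (hne : K.Nonempty) (hcl : IsClosed K) {ε B : ℝ}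
    (hε : ε ∈ widthRateSet K c τ) (hB : B < (4 + 4 / c) * (ε ^ 2 / (2 * τ))) :
    ∃ ν ∈ K, B < localWidth K ν (2 * ε) - localWidth K ν (ε / c) := by
  obtain ⟨hε0, h⟩ := hε
  have := hne.to_subtype
  obtain ⟨μ, hμ⟩ := exists_lt_of_lt_ciSup (hB.trans_le h)
  have : Nonempty (closedBall (μ : EuclideanSpace ℝ (Fin n)) ε ∩ K :
    Set (EuclideanSpace ℝ (Fin n))) := ⟨⟨μ, mem_closedBall_inter_self μ.2 hε0⟩⟩
  obtain ⟨ν, hν⟩ := exists_lt_of_ciInf_lt (lt_sub_comm.1 hμ)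
  have := localWidth_le_of_mem_closedBall hcl μ.2 ν.2 hε0
  exact ⟨ν, ν.2.2, by linarith⟩

lemma widthRate_mono (hcl : IsClosed K) (hc : 0 < c) (hτ : 0 < τ) {τ' : ℝ}
    (h : τ ≤ τ') : widthRate K c τ ≤ widthRate K c τ' := by
  refine csSup_le_csSup (bddAbove_widthRateSet hcl hc (hτ.trans_le h))
    ⟨0, zero_mem_widthRateSet hcl⟩ fun ε hε => ⟨hε.1, hε.2.le.trans' ?_⟩
  gcongr

end WidthRate

lemma le_of_sq_le_sq_of_nonneg {a b : ℝ} (h : a ^ 2 ≤ b ^ 2) (hb : 0 ≤ b) : a ≤ b :=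
  le_of_abs_le (by simpa [abs_of_nonneg hb] using sq_le_sq.1 h)

/-! ### Comparison of the worst case rate with `widthRate`. -/

section MainBounds

variable {n : ℕ} {K : Set (EuclideanSpace ℝ (Fin n))} {c σ : ℝ}

lemma widthRate_div_le_worstCaseRate (hne : K.Nonempty) (hcl : IsClosed K) (hco : Convex ℝ K)
    (hc : 1 < c) (hσ : 0 < σ) (hL : 160 * c * σ ≤ widthRate K c σ) :
    widthRate K c σ / c ≤ worstCaseRate K σ := by
  have hc0 : 0 < c := by linarith
  rw [div_le_iff₀ hc0]
  refine le_of_forall_lt fun b hb => ?_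
  have hpos : 0 < widthRate K c σ := lt_of_lt_of_le (by positivity) hL
  -- The supremum need not be attained; an admissible `ε` above half of it keeps `ε ≥ 80 * c * σ`.
  obtain ⟨ε, hε, hlt⟩ := exists_lt_of_lt_csSup ⟨0, zero_mem_widthRateSet hcl⟩
    (show max b (widthRate K c σ / 2) < sSup (widthRateSet K c σ) from
      max_lt hb (half_lt_self hpos))
  obtain ⟨hbε, hε2⟩ := max_lt_iff.1 hlt
  have hε0 : 0 < ε := by linarith
  have hεσ : 80 * c * σ ≤ ε := by linarith
  refine hbε.trans_le ?_
  rw [← div_le_iff₀ hc0]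
  -- Replacing `1 / c` by `1 / (2 * c)` gives the strict inequality needed to pick near-optimal `μ`
  -- and `ν`.
  obtain ⟨ν, hν, hw⟩ := exists_lt_of_mem_widthRateSet hne hcl hε
    (B := 2 * ((1 + 1 / (2 * c)) * ε ^ 2) / σ) (by
      rw [div_lt_iff₀ hσ]
      have e : (4 + 4 / c) * (ε ^ 2 / (2 * σ)) * σ = 2 * ((1 + 1 / c) * ε ^ 2) := by
        field_simp; ring
      have e' : 1 / (2 * c) < 1 / c := by gcongr; linarith
      rw [e]
      gcongr)
  rw [div_lt_iff₀ hσ, mul_comm _ σ] at hw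
  -- `80 ^ 2 = 6400` exceeds `6336`.
  have hsq : 6336 * c ^ 2 * σ ^ 2 ≤ ε ^ 2 := by
    have := pow_le_pow_left₀ (by positivity) hεσ 2
    nlinarith [mul_pos (pow_pos hc0 2) (pow_pos hσ 2)]
  have h := (sq_le_lseRisk hcl hco hν hσ hc hε0 hw.le hsq).trans
    (lseRisk_le_worstCaseRate_sq hcl hco hν hσ)
  exact (sq_le_sq₀ (by positivity) worstCaseRate_nonneg).1 h

/-- Beyond `widthRate` the slope of the local width between `R / c` and `R` is small. -/
lemma mul_localWidth_sub_le (hcl : IsClosed K) (hc : 1 < c) (hσ : 0 < σ) {R : ℝ} (hR0 : 0 ≤ R)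
    (hR : widthRate K c (4 * c * σ / (c - 1)) < R) {μ : EuclideanSpace ℝ (Fin n)} (hμ : μ ∈ K) :
    σ * (localWidth K μ R - localWidth K μ (R / c)) ≤ (1 - (1 / c) ^ 2) * R ^ 2 / 2 := by
  have hc0 : 0 < c := by linarith
  have hc1 : 0 < c - 1 := by linarith
  have h := (localWidth_sub_lt_of_widthRate_lt hcl hc0 (by positivity) hR0 hR hμ).le
  have h' := mul_le_mul_of_nonneg_left h hσ.le
  refine h'.trans_eq ?_
  field_simp
  ring

/-- Argue by contradiction with the worst case rate `R` itself as the radius: the slope bound then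
contracts `R ^ 2` up to a multiple of `σ ^ 2`. -/
lemma worstCaseRate_le_widthRate (hc : 1 < c) :
    ∃ L : ℝ, 0 < L ∧ ∀ (n : ℕ) (K : Set (EuclideanSpace ℝ (Fin n))) (σ : ℝ),
      K.Nonempty → IsClosed K → Convex ℝ K → 0 < σ → L * σ ≤ widthRate K c σ →
      worstCaseRate K σ ≤ widthRate K c (4 * c * σ / (c - 1)) := by
  have hc0 : 0 < c := by linarith
  have hc1 : 0 < c - 1 := by linarith
  obtain ⟨x, hx⟩ : ∃ x, x = 1 / c := ⟨_, rfl⟩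
  have hx0 : 0 < x := by rw [hx]; positivity
  have hx1 : x < 1 := by rw [hx, div_lt_one hc0]; exact hc
  -- Monotonicity bounds `σ` times the slope over `[x * R, ρ * R]` by `θ * R` with `θ = (1 - x ^ 2)
  -- / (2 * (ρ - x))`. This is below `R` once `ρ > 1 - (1 - x) ^ 2 / 2`; `ρ` is midway between that
  -- value and `1`.
  obtain ⟨ρ, hρ⟩ : ∃ ρ, ρ = 1 - (1 - x) ^ 2 / 4 := ⟨_, rfl⟩
  have hρx : ρ - x = (1 - x) * (3 + x) / 4 := by rw [hρ]; ring
  have hρx0 : 0 < ρ - x := by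
    rw [hρx]
    have := sub_pos.2 hx1
    positivity
  have hρ1 : ρ < 1 := by
    rw [hρ]
    have := pow_pos (sub_pos.2 hx1) 2
    linarith
  obtain ⟨θ, hθ⟩ : ∃ θ, θ = 2 * (1 + x) / (3 + x) := ⟨_, rfl⟩
  have hθ1 : θ < 1 := by rw [hθ, div_lt_one (by positivity)]; linarith
  have hθρ : θ * (ρ - x) = (1 - x ^ 2) / 2 := by rw [hθ, hρx]; field_simp; ring
  obtain ⟨q, hq⟩ : ∃ q, q = max ρ θ := ⟨_, rfl⟩
  have hqρ : ρ ≤ q := hq ▸ le_max_left _ _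
  have hqθ : θ ≤ q := hq ▸ le_max_right _ _
  have hq0 : 0 < q := by linarith
  have hq1 : q < 1 := hq ▸ max_lt hρ1 hθ1
  have hq1' := sub_pos.2 hq1
  obtain ⟨M, hM⟩ : ∃ M, M = 132 * (ρ / (ρ - x)) ^ 2 / (1 - q) := ⟨_, rfl⟩
  have hM0 : 0 ≤ M := by rw [hM]; positivity
  refine ⟨1 + M / (1 - q), by positivity, fun n K σ hne hcl hco hσ hL => ?_⟩
  by_contra! hR
  set R := worstCaseRate K σ
  have hσ' : σ ≤ 4 * c * σ / (c - 1) := by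
    rw [le_div_iff₀ hc1]; nlinarith
  have hLR : (1 + M / (1 - q)) * σ < R :=
    (hL.trans (widthRate_mono hcl hc0 hσ hσ')).trans_lt hR
  have hR0 : 0 < R := lt_of_le_of_lt (by positivity) hLR
  have hxR : R / c = x * R := by rw [hx]; ring
  have hrisk : ∀ μ ∈ K, lseRisk K σ μ ≤ q * R ^ 2 + M * σ ^ 2 := by
    intro μ hμ
    have hw := mul_localWidth_sub_le hcl hc hσ hR0.le hR hμ
    rw [hxR, ← hx] at hw
    have hmono : localWidth K μ (ρ * R) ≤ localWidth K μ R :=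
      localWidth_mono hcl hμ (Set.mem_Ici.2 (mul_nonneg (by linarith) hR0.le))
        (Set.mem_Ici.2 hR0.le) (by nlinarith)
    have h := lseRisk_le_of_slope_le hcl hco hμ hσ (s := x * R) (u := ρ * R) (B := q * R)
      (by positivity) (by nlinarith) (by gcongr)
      (by
        have h1 : q * R * (ρ * R - x * R) = q * (ρ - x) * R ^ 2 := by ring
        have h2 : (1 - x ^ 2) * R ^ 2 / 2 = θ * (ρ - x) * R ^ 2 := by rw [hθρ]; ring
        have h3 : σ * (localWidth K μ (ρ * R) - localWidth K μ (x * R)) ≤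
            σ * (localWidth K μ R - localWidth K μ (x * R)) := by gcongr
        rw [h1]
        rw [h2] at hw
        exact (h3.trans hw).trans (by gcongr))
      hq0 hq1
    refine h.trans_eq ?_
    have e1 : (q * R) ^ 2 / q = q * R ^ 2 := by field_simp
    have e2 : σ * (ρ * R) / (ρ * R - x * R) = σ * (ρ / (ρ - x)) := by
      rw [← sub_mul, ← mul_assoc, mul_div_mul_right _ _ hR0.ne', mul_div_assoc]
    rw [e1, e2, hM]
    ring
  have hle := worstCaseRate_sq_le hne hrisk
  change R ^ 2 ≤ q * R ^ 2 + M * σ ^ 2 at hle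
  have hsq := pow_lt_pow_left₀ hLR (by positivity) (two_ne_zero)
  have hL1 : 1 ≤ 1 + M / (1 - q) := by linarith [div_nonneg hM0 hq1'.le]
  have h1 : (M / (1 - q)) * σ ^ 2 < R ^ 2 := by
    refine lt_of_le_of_lt ?_ hsq
    rw [mul_pow]
    gcongr
    nlinarith
  rw [div_mul_eq_mul_div, div_lt_iff₀ hq1'] at h1
  linarith

/-- Concavity carries the slope bound from `[ε / c, ε]` to `[ε, 2 * ε]`. The latter does not
degenerate as `c` tends to `1`, so the constant depends on `A` only. -/
lemma worstCaseRate_le_of_widthRate_le (hne : K.Nonempty) (hcl : IsClosed K) (hco : Convex ℝ K)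
    (hc : 1 < c) (hσ : 0 < σ) {A : ℝ} (hA : 0 < A)
    (h : widthRate K c (4 * c * σ / (c - 1)) ≤ A * σ) :
    worstCaseRate K σ ≤ (8 * (A + 1) ^ 2 + 1056) * σ := by
  have hc0 : 0 < c := by linarith
  have hε0 : 0 < (A + 1) * σ := by positivity
  have hlt : widthRate K c (4 * c * σ / (c - 1)) < (A + 1) * σ := by linarith
  obtain ⟨ε, hε⟩ : ∃ ε, ε = (A + 1) * σ := ⟨_, rfl⟩
  rw [← hε] at hε0 hlt
  have hεc : ε / c < ε := div_lt_self hε0 hc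
  have hrisk : ∀ μ ∈ K, lseRisk K σ μ ≤ 8 * ε ^ 2 + 1056 * σ ^ 2 := by
    intro μ hμ
    have hw := mul_localWidth_sub_le hcl hc hσ hε0.le hlt hμ
    have hslope := (concaveOn_localWidth hcl hco hμ).slope_anti_adjacent
      (x := ε / c) (y := ε) (z := 2 * ε) (Set.mem_Ici.2 (by positivity))
      (Set.mem_Ici.2 (by positivity)) hεc (by linarith)
    have hs : σ * ((localWidth K μ ε - localWidth K μ (ε / c)) / (ε - ε / c)) ≤ ε := by
      rw [← mul_div_assoc, div_le_iff₀ (sub_pos.2 hεc)]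
      refine hw.trans ?_
      have hc1 : 1 / c ≤ 1 := (div_le_one hc0).2 hc.le
      have e1 : ε * (ε - ε / c) = (1 - 1 / c) * ε ^ 2 := by ring
      have e2 : (1 - (1 / c) ^ 2) * ε ^ 2 / 2 = (1 - 1 / c) * ε ^ 2 * ((1 + 1 / c) / 2) := by ring
      rw [e1, e2]
      exact mul_le_of_le_one_right (mul_nonneg (by linarith) (sq_nonneg _)) (by linarith)
    have hs2 := (mul_le_mul_of_nonneg_left hslope hσ.le).trans hs
    have e : 2 * ε - ε = ε := by ring
    rw [e, ← mul_div_assoc, div_le_iff₀ hε0] at hs2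
    have h := lseRisk_le_of_slope_le hcl hco hμ hσ (s := ε) (u := 2 * ε) (B := 2 * ε) (q := 1 / 2)
      hε0 (by linarith) le_rfl (by rw [e]; nlinarith) (by norm_num) (by norm_num)
    refine h.trans_eq ?_
    rw [e]
    field_simp
    ring
  have hle := worstCaseRate_sq_le hne hrisk
  refine le_of_sq_le_sq_of_nonneg (hle.trans ?_) (by positivity)
  rw [hε]
  have h1 : (8 * (A + 1) ^ 2 + 1056) ≤ (8 * (A + 1) ^ 2 + 1056) ^ 2 := by
    nlinarith [sq_nonneg (A + 1)]
  have := mul_le_mul_of_nonneg_right h1 (sq_nonneg σ)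
  linarith

lemma worstCaseRate_le_diam (hne : K.Nonempty) (hcl : IsClosed K) (hco : Convex ℝ K)
    (hσ : 0 < σ) (hd : ediam K ≠ ⊤) : worstCaseRate K σ ≤ (ediam K).toReal := by
  refine le_of_sq_le_sq_of_nonneg (worstCaseRate_sq_le hne fun μ hμ => ?_) ENNReal.toReal_nonneg
  refine (integral_mono (integrable_lseError_sq hcl hco hμ hσ)
    (integrable_const ((ediam K).toReal ^ 2)) fun ξ => ?_).trans_eq (by simp)
  refine pow_le_pow_left₀ (lseError_nonneg ξ) ?_ 2
  rw [lseError, ← dist_eq_norm, dist_edist]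
  exact ENNReal.toReal_mono hd (edist_le_ediam_of_mem (lse_mem hne hcl _) hμ)

end MainBounds

/-! ### The minimum of noise level and diameter. -/

section NoiseDiam

variable {n : ℕ} {K : Set (EuclideanSpace ℝ (Fin n))} {σ : ℝ}

lemma le_minNoiseDiam (hσ : 0 < σ) {y : ℝ} (h1 : y ≤ σ)
    (h2 : ediam K ≠ ⊤ → y ≤ (ediam K).toReal) : y ≤ minNoiseDiam K σ := by
  rw [minNoiseDiam]
  by_cases hd : ediam K = ⊤
  · rw [hd, min_eq_left le_top, ENNReal.toReal_ofReal hσ.le]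
    exact h1
  · rw [ENNReal.toReal_min ENNReal.ofReal_ne_top hd, ENNReal.toReal_ofReal hσ.le]
    exact le_min h1 (h2 hd)

lemma minNoiseDiam_nonneg : 0 ≤ minNoiseDiam K σ := ENNReal.toReal_nonneg

lemma minNoiseDiam_le (hσ : 0 < σ) : minNoiseDiam K σ ≤ σ := by
  rw [minNoiseDiam]
  refine (ENNReal.toReal_mono ENNReal.ofReal_ne_top (min_le_left _ _)).trans_eq ?_
  exact ENNReal.toReal_ofReal hσ.le

lemma exists_half_minNoiseDiam_lt_dist (h : 0 < minNoiseDiam K σ) :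
    ∃ p ∈ K, ∃ q ∈ K, minNoiseDiam K σ / 2 < dist p q := by
  by_contra! hall
  have hd : ediam K ≤ ENNReal.ofReal (minNoiseDiam K σ / 2) := ediam_le fun p hp q hq => by
    rw [edist_dist]
    exact ENNReal.ofReal_le_ofReal (hall p hp q hq)
  have h1 := ENNReal.toReal_mono ENNReal.ofReal_ne_top
    ((min_le_right (ENNReal.ofReal σ) (ediam K)).trans hd)
  rw [ENNReal.toReal_ofReal (by positivity)] at h1
  change minNoiseDiam K σ ≤ _ at h1
  linarith

end NoiseDiam

/-! ### The two-point lower bound. -/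

section TwoPoint

variable {n : ℕ} {K : Set (EuclideanSpace ℝ (Fin n))} {σ : ℝ}

/-- The probability that a standard normal variable is at least `1`. -/
noncomputable def gaussianTailOne : ℝ := (gaussianReal 0 1).real (Set.Ici 1)

lemma gaussianTailOne_pos : 0 < gaussianTailOne := by
  rw [gaussianTailOne, measureReal_def]
  refine ENNReal.toReal_pos (fun h => ?_) (measure_ne_top _ _)
  have := gaussianReal_absolutelyContinuous' 0 (one_ne_zero) h
  simp at this

lemma stdGaussian_real_inner_ge_one {e : EuclideanSpace ℝ (Fin n)} (he : ‖e‖ = 1) :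
    (stdGaussian (EuclideanSpace ℝ (Fin n))).real {ξ | 1 ≤ ⟪e, ξ⟫} = gaussianTailOne := by
  have h := IsGaussian.map_eq_gaussianReal (μ := stdGaussian (EuclideanSpace ℝ (Fin n)))
    (innerSL ℝ e)
  rw [integral_strongDual_stdGaussian, variance_dual_stdGaussian, innerSL_apply_norm, he] at h
  rw [gaussianTailOne, measureReal_def, measureReal_def]
  have h1 : (1 ^ 2 : ℝ).toNNReal = 1 := by simp
  rw [← h1, ← h, Measure.map_apply (by fun_prop) measurableSet_Ici]
  rfl

/-- Moving the observation along `e` cannot decrease the projection's `e`-coordinate, by firm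
nonexpansiveness. -/
lemma inner_lse_mono (hne : K.Nonempty) (hcl : IsClosed K) (hco : Convex ℝ K)
    {e y z : EuclideanSpace ℝ (Fin n)} {a : ℝ} (ha : 0 ≤ a) (h : y = z + a • e) :
    ⟪e, lse K z⟫ ≤ ⟪e, lse K y⟫ := by
  rcases ha.eq_or_lt with rfl | ha
  · simp [h]
  have h1 := norm_lse_sub_sq_le_inner hne hcl hco y z
  rw [h, add_sub_cancel_left, real_inner_smul_left, ← h] at h1
  have h2 : 0 ≤ a * ⟪e, lse K y - lse K z⟫ := (sq_nonneg _).trans h1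
  have h3 := nonneg_of_mul_nonneg_right h2 ha
  rw [inner_sub_right] at h3
  linarith

lemma mul_real_le_lseRisk (hcl : IsClosed K) (hco : Convex ℝ K) (hσ : 0 < σ)
    {μ : EuclideanSpace ℝ (Fin n)} (hμ : μ ∈ K) {S : Set (EuclideanSpace ℝ (Fin n))}
    (hS : MeasurableSet S) {b : ℝ} (hb : 0 ≤ b) (h : ∀ ξ ∈ S, b ≤ lseError K σ μ ξ) :
    b ^ 2 * (stdGaussian (EuclideanSpace ℝ (Fin n))).real S ≤ lseRisk K σ μ := by
  have h1 : ∫ ξ, S.indicator (fun _ => b ^ 2) ξ ∂(stdGaussian (EuclideanSpace ℝ (Fin n))) =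
      b ^ 2 * (stdGaussian (EuclideanSpace ℝ (Fin n))).real S := by
    rw [integral_indicator_const _ hS, smul_eq_mul, mul_comm]
  rw [← h1]
  refine integral_mono ((integrable_const _).indicator hS)
    (integrable_lseError_sq hcl hco hμ hσ) fun ξ => ?_
  by_cases hξ : ξ ∈ S
  · rw [Set.indicator_of_mem hξ]
    exact pow_le_pow_left₀ hb (h ξ hξ) 2
  · rw [Set.indicator_of_notMem hξ]
    exact sq_nonneg _

/-- A two-point lower bound, by reflection of the noise in the direction of the two points. -/
lemma mul_gaussianTailOne_le_lseRisk_add (hcl : IsClosed K) (hco : Convex ℝ K) (hσ : 0 < σ)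
    {p e : EuclideanSpace ℝ (Fin n)} {l : ℝ} (hp : p ∈ K) (hq : p + l • e ∈ K) (he : ‖e‖ = 1)
    (hl0 : 0 ≤ l) (hlσ : l ≤ σ) :
    (l / 2) ^ 2 * gaussianTailOne ≤ lseRisk K σ p + lseRisk K σ (p + l • e) := by
  have hne : K.Nonempty := ⟨p, hp⟩
  set γ := stdGaussian (EuclideanSpace ℝ (Fin n))
  have hee : ⟪e, e⟫ = 1 := by rw [real_inner_self_eq_norm_sq, he, one_pow]
  -- `h` ignores the `e`-component of the noise. If `h ξ ≥ l / 2`, noise pushing forward hurts at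
  -- `p`; otherwise noise pushing backward hurts at `p + l • e`.
  let h : EuclideanSpace ℝ (Fin n) → ℝ :=
    fun ξ => ⟪e, lse K (p + σ • (ξ - ⟪e, ξ⟫ • e)) - p⟫
  have hcont : Continuous h := by
    have := continuous_lse hne hcl hco
    fun_prop
  let S : Set (EuclideanSpace ℝ (Fin n)) := {ξ | l / 2 ≤ h ξ} ∩ {ξ | 1 ≤ ⟪e, ξ⟫}
  let S' : Set (EuclideanSpace ℝ (Fin n)) := {ξ | 1 ≤ ⟪e, ξ⟫} \ {ξ | l / 2 ≤ h ξ}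
  let T : Set (EuclideanSpace ℝ (Fin n)) := {ξ | ⟪e, ξ⟫ ≤ -1} \ {ξ | l / 2 ≤ h ξ}
  have hmh : MeasurableSet {ξ | l / 2 ≤ h ξ} := measurableSet_le (by fun_prop) hcont.measurable
  have hmz : MeasurableSet {ξ : EuclideanSpace ℝ (Fin n) | 1 ≤ ⟪e, ξ⟫} :=
    measurableSet_le (by fun_prop) (by fun_prop)
  have hmz' : MeasurableSet {ξ : EuclideanSpace ℝ (Fin n) | ⟪e, ξ⟫ ≤ -1} :=
    measurableSet_le (by fun_prop) (by fun_prop)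
  -- Reflecting the `e`-component preserves both the Gaussian and `h`, so the two bad events
  -- together have the probability of `1 ≤ ⟪e, ξ⟫`.
  have hTS : γ.real T = γ.real S' := by
    let ρ := (ℝ ∙ e)ᗮ.reflection
    have hρ : ∀ ξ, ρ ξ = ξ - (2 * ⟪e, ξ⟫) • e := fun ξ => by
      simp only [ρ, Submodule.reflection_orthogonal_apply, Submodule.reflection_singleton_apply, he]
      simp
      module
    have hz : ∀ ξ, ⟪e, ρ ξ⟫ = -⟪e, ξ⟫ := fun ξ => by
      rw [hρ, inner_sub_right, real_inner_smul_right, hee]; ring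
    have hh : ∀ ξ, h (ρ ξ) = h ξ := fun ξ => by
      simp only [h, hz]
      rw [hρ]
      congr 5
      module
    have hpre : ρ ⁻¹' T = S' := by
      ext ξ
      simp only [T, S', Set.mem_preimage, Set.mem_sdiff, Set.mem_ofPred_eq, hz, hh, neg_le_neg_iff]
    have hmap : γ.map ρ = γ := stdGaussian_map ρ
    rw [measureReal_def, measureReal_def, ← hpre, ← Measure.map_apply (by fun_prop)
      (hmz'.diff hmh), hmap]
  have hST : γ.real S + γ.real T = gaussianTailOne := by
    rw [hTS, ← stdGaussian_real_inner_ge_one he, add_comm]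
    simp only [S, S']
    rw [Set.inter_comm, add_comm]
    exact measureReal_inter_add_sdiff hmh
  rw [← hST, mul_add]
  refine add_le_add (mul_real_le_lseRisk hcl hco hσ hp (hmh.inter hmz) (by positivity) ?_)
    (mul_real_le_lseRisk hcl hco hσ hq (hmz'.diff hmh) (by positivity) ?_)
  · rintro ξ ⟨h1, h2⟩
    have h1' : l / 2 ≤ h ξ := h1
    have h2' : 1 ≤ ⟪e, ξ⟫ := h2
    have hm := inner_lse_mono hne hcl hco (e := e) (y := p + σ • ξ)
      (z := p + σ • (ξ - ⟪e, ξ⟫ • e)) (a := σ * ⟪e, ξ⟫) (by positivity) (by module)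
    have h3 := real_inner_le_norm e (lse K (p + σ • ξ) - p)
    rw [he, one_mul, inner_sub_right] at h3
    simp only [h, inner_sub_right] at h1'
    rw [lseError]
    linarith
  · rintro ξ ⟨h1, h2⟩
    have h1' : ⟪e, ξ⟫ ≤ -1 := h1
    have h2' : h ξ < l / 2 := not_le.1 h2
    -- `l ≤ σ` and `⟪e, ξ⟫ ≤ -1` make the shift `-l - σ * ⟪e, ξ⟫` nonnegative.
    have hm := inner_lse_mono hne hcl hco (e := e) (y := p + σ • (ξ - ⟪e, ξ⟫ • e))
      (z := p + l • e + σ • ξ) (a := -l - σ * ⟪e, ξ⟫) (by nlinarith) (by module)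
    have h3 := neg_le_of_abs_le (abs_real_inner_le_norm e (lse K (p + l • e + σ • ξ) - (p + l • e)))
    rw [he, one_mul, inner_sub_right, inner_add_right, real_inner_smul_right, hee] at h3
    simp only [h, inner_sub_right] at h2'
    rw [lseError]
    linarith

lemma mul_minNoiseDiam_le_worstCaseRate (hcl : IsClosed K) (hco : Convex ℝ K) (hσ : 0 < σ) :
    √(gaussianTailOne / 32) * minNoiseDiam K σ ≤ worstCaseRate K σ := by
  rcases (minNoiseDiam_nonneg (K := K) (σ := σ)).eq_or_lt with h0 | h0
  · rw [← h0, mul_zero]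
    exact worstCaseRate_nonneg
  obtain ⟨p, hp, q, hq, hpq⟩ := exists_half_minNoiseDiam_lt_dist h0
  set m := minNoiseDiam K σ
  have hmσ : m ≤ σ := minNoiseDiam_le hσ
  have hd : 0 < ‖q - p‖ := by
    rw [← dist_eq_norm, dist_comm]; linarith
  have hpq' : m / 2 < ‖q - p‖ := by rwa [← dist_eq_norm, dist_comm]
  let e := ‖q - p‖⁻¹ • (q - p)
  have he : ‖e‖ = 1 := by
    simp only [e]
    rw [norm_smul, norm_inv, norm_norm, inv_mul_cancel₀ hd.ne']
  have hq' : p + (m / 2) • e ∈ K := by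
    have h1 : p + (m / 2) • e = p + (m / 2 * ‖q - p‖⁻¹) • (q - p) := by
      simp only [e]; rw [smul_smul]
    rw [h1]
    refine hco.add_smul_sub_mem hp hq ⟨by positivity, ?_⟩
    rw [← div_eq_mul_inv, div_le_one hd]
    exact hpq'.le
  -- With `l = m / 2` the left side is `m ^ 2 / 16` times the tail, and two risks are summed, whence
  -- `32`.
  have h := mul_gaussianTailOne_le_lseRisk_add hcl hco hσ hp hq' he (by positivity) (by linarith)
  have h1 := lseRisk_le_worstCaseRate_sq hcl hco hp hσ
  have h2 := lseRisk_le_worstCaseRate_sq hcl hco hq' hσ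
  refine le_of_sq_le_sq_of_nonneg ?_ worstCaseRate_nonneg
  rw [mul_pow, Real.sq_sqrt (div_nonneg gaussianTailOne_pos.le (by norm_num))]
  linarith

end TwoPoint

theorem theorem2p14 :
    (∀ c : ℝ, 1 < c → ∃ L : ℝ, 0 < L ∧
      ∀ (n : ℕ) (K : Set (EuclideanSpace ℝ (Fin n))) (σ : ℝ),
        K.Nonempty → IsClosed K → Convex ℝ K → 0 < σ →
        L * σ ≤ widthRate K c σ →
          widthRate K c σ / c ≤ worstCaseRate K σ ∧
          worstCaseRate K σ ≤ widthRate K c (4 * c * σ / (c - 1))) ∧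
    (∀ A : ℝ, 0 < A → ∃ a b : ℝ, 0 < a ∧ 0 < b ∧
      ∀ (c : ℝ) (n : ℕ) (K : Set (EuclideanSpace ℝ (Fin n))) (σ : ℝ),
        1 < c → K.Nonempty → IsClosed K → Convex ℝ K → 0 < σ →
        widthRate K c (4 * c * σ / (c - 1)) ≤ A * σ →
          a * minNoiseDiam K σ ≤ worstCaseRate K σ ∧
          worstCaseRate K σ ≤ b * minNoiseDiam K σ) := by
  refine ⟨fun c hc => ?_, fun A hA => ?_⟩
  · obtain ⟨L, hL0, hL⟩ := worstCaseRate_le_widthRate hc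
    refine ⟨max L (160 * c), lt_max_of_lt_left hL0, fun n K σ hne hcl hco hσ h => ⟨?_, ?_⟩⟩
    · refine widthRate_div_le_worstCaseRate hne hcl hco hc hσ (le_trans ?_ h)
      gcongr
      exact le_max_right _ _
    · refine hL n K σ hne hcl hco hσ (le_trans ?_ h)
      gcongr
      exact le_max_left _ _
  · have hb : 0 < 8 * (A + 1) ^ 2 + 1056 := by positivity
    refine ⟨√(gaussianTailOne / 32), 8 * (A + 1) ^ 2 + 1056,
      Real.sqrt_pos.2 (div_pos gaussianTailOne_pos (by norm_num)), hb,
      fun c n K σ hc hne hcl hco hσ h =>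
        ⟨mul_minNoiseDiam_le_worstCaseRate hcl hco hσ, ?_⟩⟩
    rw [← div_le_iff₀' hb]
    refine le_minNoiseDiam hσ ?_ fun hd => ?_
    · rw [div_le_iff₀' hb]
      exact worstCaseRate_le_of_widthRate_le hne hcl hco hc hσ hA h
    · refine (div_le_self worstCaseRate_nonneg ?_).trans (worstCaseRate_le_diam hne hcl hco hσ hd)
      nlinarith [sq_nonneg (A + 1)]
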